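/- Let $A$ be a von Neumann algebra acting on a complex Hilbert space and let $A_{sa}$ be its set of self-adjoint elements. For $a\in A_{sa}$ let $(e^a_x)_{x\in\mathbb{R}}$, $e^a_x=\chi_{(-\infty,x]}(a)$, be the spectral resolution of $a$, and let $\leq_s$ be the spectral order on $A_{sa}$: $a\leq_s b$ if and only if $e^a_x\geq e^b_x$ for all $x\in\mathbb{R}$. A context of $A$ is an abelian von Neumann subalgebra $C\subseteq A$ (containing the unit of $A$); write $C_{sa}=C\cap A_{sa}$. For $a\in A_{sa}$ and a context $C$ the outer and inner daseinisation of $a$ in $C$ are $$\delta^{o}(a)_{C}:=\bigwedge\{b\in C_{sa}\mid a\leq_{s}b\},\qquad \delta^{i}(a)_{C}:=\bigvee\{b\in C_{sa}\mid b\leq_{s}a\},$$ where the meet and the join are taken in $A_{sa}$ with respect to the spectral order. Corollary 5.16. Let $h:A\to A$ be a $*$-automorphism, $a\in A_{sa}$ and $C$ a context of $A$. Then $h[C]$ is a context of $A$, the meets and joins defining $\delta^{o}(a)_{C}$, $\delta^{i}(a)_{C}$, $\delta^{o}(h(a))_{h[C]}$ and $\delta^{i}(h(a))_{h[C]}$ exist,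 the first two lie in $C_{sa}$ and the last two in $h[C]_{sa}$, and $$h(\delta^{o}(a)_{C})=\delta^{o}(h(a))_{h[C]},\qquad h(\delta^{i}(a)_{C})=\delta^{i}(h(a))_{h[C]}.$$ -/

import Mathlib

/-- The projection `e^a_x = χ_{(-∞, x]}(a)` of the spectral resolution of a bounded self-adjoint
operator `a`: the orthogonal projection onto the kernel of the positive part `(a - x)⁺`, which is
obtained from `a` by the continuous functional calculus for `t ↦ max (t - x) 0`. -/
noncomputable def spectralProjection {H : Type*} [NormedAddCommGroup H] [InnerProductSpace ℂ H]
    [CompleteSpace H] (a : H →L[ℂ] H) (x : ℝ) : H →L[ℂ] H :=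
  (cfc (fun t : ℝ => max (t - x) 0) a).ker.starProjection

/-- The set `A_sa` of self-adjoint elements of a von Neumann algebra `A`. -/
@[ext]
structure SelfAdjointPart {H : Type*} [NormedAddCommGroup H] [InnerProductSpace ℂ H]
    [CompleteSpace H] (A : VonNeumannAlgebra H) where
  /-- the underlying bounded operator -/
  val : H →L[ℂ] H
  mem : val ∈ A
  isSelfAdjoint : IsSelfAdjoint val

/-- The spectral order on `A_sa`: `a ≤ b` means `e^b_x ≤ e^a_x` for every real `x`, where
projections are compared in the usual operator order. -/
instance SelfAdjointPart.spectralOrder {H : Type*} [NormedAddCommGroup H]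
    [InnerProductSpace ℂ H] [CompleteSpace H] (A : VonNeumannAlgebra H) :
    Preorder (SelfAdjointPart A) where
  le a b := ∀ x : ℝ, spectralProjection b.val x ≤ spectralProjection a.val x
  le_refl _ _ := le_rfl
  le_trans _ _ _ hab hbc x := (hbc x).trans (hab x)

/-- A context of `A`: an abelian von Neumann subalgebra of `A` (with the same unit). -/
structure Context {H : Type*} [NormedAddCommGroup H] [InnerProductSpace ℂ H]
    [CompleteSpace H] (A : VonNeumannAlgebra H) where
  /-- the underlying von Neumann algebra -/
  algebra : VonNeumannAlgebra H
  le : algebra ≤ A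
  comm : ∀ b ∈ algebra, ∀ c ∈ algebra, b * c = c * b

/-- The set `{b ∈ C_sa | a ≤ₛ b}`. -/
def Context.above {H : Type*} [NormedAddCommGroup H] [InnerProductSpace ℂ H]
    [CompleteSpace H] {A : VonNeumannAlgebra H} (C : Context A) (a : SelfAdjointPart A) :
    Set (SelfAdjointPart A) :=
  {b | b.val ∈ C.algebra ∧ a ≤ b}

/-- The set `{b ∈ C_sa | b ≤ₛ a}`. -/
def Context.below {H : Type*} [NormedAddCommGroup H] [InnerProductSpace ℂ H]
    [CompleteSpace H] {A : VonNeumannAlgebra H} (C : Context A) (a : SelfAdjointPart A) :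
    Set (SelfAdjointPart A) :=
  {b | b.val ∈ C.algebra ∧ b ≤ a}

open Classical in
/-- Outer daseinisation `δᵒ(a)_C = ⋀ {b ∈ C_sa | a ≤ₛ b}`, the meet being that of `A_sa` in the
spectral order (with the value `a` should there be no meet). -/
noncomputable def outerDaseinisation {H : Type*} [NormedAddCommGroup H] [InnerProductSpace ℂ H]
    [CompleteSpace H] {A : VonNeumannAlgebra H} (a : SelfAdjointPart A) (C : Context A) :
    SelfAdjointPart A :=
  if hd : ∃ d, IsGLB (C.above a) d then hd.choose else a

open Classical in
/-- Inner daseinisation `δⁱ(a)_C = ⋁ {b ∈ C_sa | b ≤ₛ a}`, the join being that of `A_sa` in the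
spectral order (with the value `a` should there be no join). -/
noncomputable def innerDaseinisation {H : Type*} [NormedAddCommGroup H] [InnerProductSpace ℂ H]
    [CompleteSpace H] {A : VonNeumannAlgebra H} (a : SelfAdjointPart A) (C : Context A) :
    SelfAdjointPart A :=
  if hd : ∃ d, IsLUB (C.below a) d then hd.choose else a

/-- The action of a `*`-automorphism of `A` on `A_sa`. -/
noncomputable def SelfAdjointPart.map {H : Type*} [NormedAddCommGroup H] [InnerProductSpace ℂ H]
    [CompleteSpace H] {A : VonNeumannAlgebra H}
    (h : A.toStarSubalgebra ≃⋆ₐ[ℂ] A.toStarSubalgebra) (a : SelfAdjointPart A) :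
    SelfAdjointPart A where
  val := h ⟨a.val, a.mem⟩
  mem := (h ⟨a.val, a.mem⟩).2
  isSelfAdjoint := by
    have ha : star (⟨a.val, a.mem⟩ : A.toStarSubalgebra) = ⟨a.val, a.mem⟩ :=
      Subtype.ext a.isSelfAdjoint
    have h1 : star (h ⟨a.val, a.mem⟩) = h ⟨a.val, a.mem⟩ := by rw [← map_star, ha]
    exact congrArg Subtype.val h1

/-! A `*`-automorphism `h` preserves whatever is determined by the algebraic operations. Spectral
projections are of this kind: `h` is automatically isometric, so it respects the continuous
functional calculus, and the kernel projection of `b` is the largest projection `p` with `b * p = 0`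
(`map_starProjection_ker`). Hence `h` is an order isomorphism of `A_sa` for the spectral order
(`mapOrderIso`). It carries the sets that define the daseinisations in `C` to those for `h[C]`, and
with them their meets and joins.

Two existence questions remain. Meets and joins are obtained by operating pointwise on spectral
families and turning the resulting family back into an operator. This needs a form of the spectral
theorem: a bounded, monotone, right-continuous family of subspaces comes from a self-adjoint
operator (`exists_spectralSubspace_eq`), and that operator is unique (`eq_of_spectralSubspace_eq`).

The other question is why `h[C]` equals its bicommutant, since no weak continuity of `h` is given.
What visibly survives under `h` is norm-closedness, commutativity, the presence of spectral
projections, and closure of the projections under infima. By `centralizer_centralizer_eq` these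
properties suffice: von Neumann's one-vector density argument and a Borel-Cantelli argument show
that every projection of the bicommutant already lies in the algebra. -/

/-! ### Spectral subspaces characterised by quadratic form inequalities -/

section SpectralSubspace

variable {H : Type*} [NormedAddCommGroup H] [InnerProductSpace ℂ H]

theorem Submodule.apply_mem_of_commute_starProjection {K : Submodule ℂ H}
    [K.HasOrthogonalProjection] {T : H →L[ℂ] H} (hT : Commute T K.starProjection) {ξ : H}
    (hξ : ξ ∈ K) : T ξ ∈ K := by
  have h := congrArg (fun S : H →L[ℂ] H => S ξ) hT.eq
  simp only [mul_apply_eq_comp, K.starProjection_eq_self_iff.2 hξ] at h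
  exact K.starProjection_eq_self_iff.1 h.symm

theorem Submodule.apply_mem_orthogonal_of_commute_starProjection {K : Submodule ℂ H}
    [K.HasOrthogonalProjection] {T : H →L[ℂ] H} (hT : Commute T K.starProjection) {ξ : H}
    (hξ : ξ ∈ Kᗮ) : T ξ ∈ Kᗮ := by
  refine Submodule.apply_mem_of_commute_starProjection ?_ hξ
  rw [Submodule.starProjection_orthogonal']
  exact (Commute.one_right T).sub_right hT

/-- `T` leaves both `K` and `Kᗮ` invariant, so the cross terms vanish. -/
theorem Submodule.reApplyInnerSelf_eq_add {K : Submodule ℂ H}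
    [K.HasOrthogonalProjection] {T : H →L[ℂ] H} (hT : Commute T K.starProjection) (ξ : H) :
    T.reApplyInnerSelf ξ = T.reApplyInnerSelf (K.starProjection ξ) +
      T.reApplyInnerSelf (Kᗮ.starProjection ξ) := by
  set u := K.starProjection ξ
  set v := Kᗮ.starProjection ξ
  have hu : u ∈ K := K.starProjection_apply_mem ξ
  have hv : v ∈ Kᗮ := Kᗮ.starProjection_apply_mem ξ
  have h : ξ = u + v := (K.starProjection_add_starProjection_orthogonal ξ).symm
  have h1 : inner ℂ (T u) v = 0 :=
    Submodule.inner_right_of_mem_orthogonal (apply_mem_of_commute_starProjection hT hu) hv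
  have h2 : inner ℂ (T v) u = 0 :=
    Submodule.inner_left_of_mem_orthogonal hu (apply_mem_orthogonal_of_commute_starProjection hT hv)
  rw [h]
  simp only [ContinuousLinearMap.reApplyInnerSelf_apply, map_add, inner_add_left, inner_add_right,
    h1, h2]
  simp

theorem ContinuousLinearMap.reApplyInnerSelf_nonneg {T : H →L[ℂ] H} (hT : 0 ≤ T) (ξ : H) :
    0 ≤ T.reApplyInnerSelf ξ :=
  ((ContinuousLinearMap.nonneg_iff_isPositive T).1 hT).re_inner_nonneg_left ξ

theorem reApplyInnerSelf_algebraMap (x : ℝ) (ξ : H) :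
    (algebraMap ℝ (H →L[ℂ] H) x).reApplyInnerSelf ξ = x * ‖ξ‖ ^ 2 := by
  rw [ContinuousLinearMap.reApplyInnerSelf_apply, Algebra.algebraMap_eq_smul_one,
    smul_apply, one_apply_eq_self, inner_smul_left_eq_smul,
    RCLike.smul_re, inner_self_eq_norm_sq]

theorem ContinuousLinearMap.reApplyInnerSelf_add_sub (S T U : H →L[ℂ] H) (ξ : H) :
    (S + T - U).reApplyInnerSelf ξ =
      S.reApplyInnerSelf ξ + T.reApplyInnerSelf ξ - U.reApplyInnerSelf ξ := by
  simp [ContinuousLinearMap.reApplyInnerSelf_apply, inner_sub_left, inner_add_left]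

variable [CompleteSpace H]

/-- The closed subspace `ker (a - x)⁺` onto which the spectral projection projects. -/
noncomputable def spectralSubspace (a : H →L[ℂ] H) (x : ℝ) : Submodule ℂ H :=
  (cfc (fun t : ℝ => max (t - x) 0) a).ker

instance (a : H →L[ℂ] H) (x : ℝ) : CompleteSpace (spectralSubspace a x) :=
  (ContinuousLinearMap.isClosed_ker (cfc (fun t : ℝ => max (t - x) 0) a)).completeSpace_coe

theorem spectralProjection_eq (a : H →L[ℂ] H) (x : ℝ) :
    spectralProjection a x = (spectralSubspace a x).starProjection := rfl

theorem spectralProjection_le_iff {a b : H →L[ℂ] H} {x y : ℝ} :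
    spectralProjection a x ≤ spectralProjection b y ↔
      spectralSubspace a x ≤ spectralSubspace b y := by
  rw [spectralProjection_eq, spectralProjection_eq, Submodule.starProjection_le_starProjection_iff]

theorem eq_add_sub_cfc {a : H →L[ℂ] H} (ha : IsSelfAdjoint a) (x : ℝ) :
    a = algebraMap ℝ (H →L[ℂ] H) x + cfc (fun t : ℝ => max (t - x) 0) a -
      cfc (fun t : ℝ => max (x - t) 0) a := by
  conv_lhs => rw [← cfc_id ℝ a]
  rw [← cfc_const x a, ← cfc_add .., ← cfc_sub ..]
  congr 1
  funext t
  simp only [id]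
  rcases le_total t x with h | h
  · rw [max_eq_right (by linarith), max_eq_left (by linarith)]; ring
  · rw [max_eq_left (by linarith), max_eq_right (by linarith)]; ring

theorem cfc_mul_cfc_eq_zero (a : H →L[ℂ] H) (x : ℝ) :
    cfc (fun t : ℝ => max (x - t) 0) a * cfc (fun t : ℝ => max (t - x) 0) a = 0 := by
  rw [← cfc_mul ..]
  convert cfc_zero ℝ a using 2
  funext t
  rcases le_total t x with h | h
  · simp [h]
  · simp [h]

theorem cfc_mul_cfc_eq_zero' (a : H →L[ℂ] H) (x : ℝ) :
    cfc (fun t : ℝ => max (t - x) 0) a * cfc (fun t : ℝ => max (x - t) 0) a = 0 := by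
  rw [← cfc_mul_cfc_eq_zero a x, cfc_commute_cfc]

theorem ContinuousLinearMap.apply_eq_zero_of_reApplyInnerSelf_eq_zero {T : H →L[ℂ] H}
    (hT : 0 ≤ T) {ξ : H} (h : T.reApplyInnerSelf ξ = 0) : T ξ = 0 := by
  obtain ⟨S, rfl⟩ := CStarAlgebra.nonneg_iff_eq_star_mul_self.1 hT
  rw [ContinuousLinearMap.reApplyInnerSelf_apply, mul_apply_eq_comp,
    ContinuousLinearMap.star_eq_adjoint, ContinuousLinearMap.adjoint_inner_left,
    inner_self_eq_norm_sq] at h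
  have : S ξ = 0 := by simpa using h
  rw [mul_apply_eq_comp, this, map_zero]

theorem reApplyInnerSelf_le_of_mem_spectralSubspace {a : H →L[ℂ] H} (ha : IsSelfAdjoint a)
    {x : ℝ} {ξ : H} (hξ : ξ ∈ spectralSubspace a x) : a.reApplyInnerSelf ξ ≤ x * ‖ξ‖ ^ 2 := by
  have h0 : cfc (fun t : ℝ => max (t - x) 0) a ξ = 0 := hξ
  have h1 := ContinuousLinearMap.reApplyInnerSelf_nonneg
    (cfc_nonneg (a := a) (f := fun t : ℝ => max (x - t) 0)
      (fun t _ => le_max_right _ _)) ξ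
  rw [eq_add_sub_cfc ha x, ContinuousLinearMap.reApplyInnerSelf_add_sub,
    reApplyInnerSelf_algebraMap]
  rw [ContinuousLinearMap.reApplyInnerSelf_apply (cfc (fun t : ℝ => max (t - x) 0) a), h0]
  simpa using h1

theorem reApplyInnerSelf_eq_of_mem_orthogonal {a : H →L[ℂ] H} (ha : IsSelfAdjoint a)
    {x : ℝ} {ξ : H} (hξ : ξ ∈ (spectralSubspace a x)ᗮ) :
    a.reApplyInnerSelf ξ = x * ‖ξ‖ ^ 2 +
      (cfc (fun t : ℝ => max (t - x) 0) a).reApplyInnerSelf ξ := by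
  -- The positive and negative parts of `a - x` multiply to zero, so the negative part maps into the
  -- kernel of the positive part, which is orthogonal to `ξ`.
  have h0 : cfc (fun t : ℝ => max (x - t) 0) a ξ ∈ spectralSubspace a x := by
    change cfc (fun t : ℝ => max (t - x) 0) a (cfc (fun t : ℝ => max (x - t) 0) a ξ) = 0
    rw [← mul_apply_eq_comp, cfc_mul_cfc_eq_zero']
    rfl
  have h1 : (cfc (fun t : ℝ => max (x - t) 0) a).reApplyInnerSelf ξ = 0 := by
    rw [ContinuousLinearMap.reApplyInnerSelf_apply,
      Submodule.inner_right_of_mem_orthogonal h0 hξ, map_zero]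
  conv_lhs => rw [eq_add_sub_cfc ha x, ContinuousLinearMap.reApplyInnerSelf_add_sub,
    reApplyInnerSelf_algebraMap, h1, sub_zero]

/-- Equality would make the form of the positive part vanish at `ξ`, putting `ξ` in the kernel as
well as in its complement. The strictness is what assigns an eigenvalue equal to `x` to the subspace
and makes the cut at `x` unique. -/
theorem lt_reApplyInnerSelf_of_mem_orthogonal {a : H →L[ℂ] H} (ha : IsSelfAdjoint a)
    {x : ℝ} {ξ : H} (hξ : ξ ∈ (spectralSubspace a x)ᗮ) (h0 : ξ ≠ 0) :
    x * ‖ξ‖ ^ 2 < a.reApplyInnerSelf ξ := by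
  have hb : 0 ≤ cfc (fun t : ℝ => max (t - x) 0) a := cfc_nonneg fun t _ => le_max_right _ _
  rw [reApplyInnerSelf_eq_of_mem_orthogonal ha hξ]
  refine lt_add_of_pos_right _ (lt_of_le_of_ne
    (ContinuousLinearMap.reApplyInnerSelf_nonneg hb ξ) fun h => h0 ?_)
  have h1 : ξ ∈ spectralSubspace a x :=
    ContinuousLinearMap.apply_eq_zero_of_reApplyInnerSelf_eq_zero hb h.symm
  exact inner_self_eq_zero.1 (Submodule.inner_right_of_mem_orthogonal h1 hξ)

theorem Submodule.commute_starProjection {K : Submodule ℂ H} [K.HasOrthogonalProjection]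
    {T : H →L[ℂ] H} (h : ∀ ξ ∈ K, T ξ ∈ K) (h' : ∀ ξ ∈ K, star T ξ ∈ K) :
    Commute T K.starProjection := by
  refine ContinuousLinearMap.ext fun ξ => Eq.symm ?_
  refine Submodule.eq_starProjection_of_mem_orthogonal (h _ (K.starProjection_apply_mem ξ)) ?_
  change T ξ - T (K.starProjection ξ) ∈ Kᗮ
  rw [← map_sub]
  intro η hη
  rw [← ContinuousLinearMap.adjoint_inner_left]
  exact Submodule.inner_right_of_mem_orthogonal (h' η hη) (K.sub_starProjection_mem_orthogonal ξ)

theorem apply_mem_spectralSubspace {a T : H →L[ℂ] H} (hT : Commute a T) {x : ℝ} {ξ : H}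
    (hξ : ξ ∈ spectralSubspace a x) : T ξ ∈ spectralSubspace a x := by
  have h : (cfc (fun t : ℝ => max (t - x) 0) a * T) ξ =
      (T * cfc (fun t : ℝ => max (t - x) 0) a) ξ := by rw [(hT.cfc_real _).eq]
  have h0 : cfc (fun t : ℝ => max (t - x) 0) a ξ = 0 := hξ
  rw [mul_apply_eq_comp, mul_apply_eq_comp, h0, map_zero] at h
  exact h

theorem commute_starProjection_spectralSubspace {a T : H →L[ℂ] H} (ha : IsSelfAdjoint a)
    (hT : Commute a T) (x : ℝ) : Commute T (spectralSubspace a x).starProjection := by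
  refine Submodule.commute_starProjection (fun ξ hξ => apply_mem_spectralSubspace hT hξ)
    fun ξ hξ => apply_mem_spectralSubspace ?_ hξ
  simpa [ha.star_eq] using hT.star_star

omit [CompleteSpace H] in
theorem Submodule.starProjection_orthogonal_apply_eq_zero_iff {K : Submodule ℂ H}
    [K.HasOrthogonalProjection] {ξ : H} : Kᗮ.starProjection ξ = 0 ↔ ξ ∈ K := by
  rw [Submodule.starProjection_orthogonal_val, sub_eq_zero, eq_comm,
    Submodule.starProjection_eq_self_iff]

/-- A closed subspace that cuts the self-adjoint operator `a` at the level `x` is the spectral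
subspace of `a` at `x`. -/
theorem spectralSubspace_eq {a : H →L[ℂ] H} (ha : IsSelfAdjoint a) {x : ℝ} {K : Submodule ℂ H}
    [K.HasOrthogonalProjection] (hc : Commute a K.starProjection)
    (hle : ∀ ξ ∈ K, a.reApplyInnerSelf ξ ≤ x * ‖ξ‖ ^ 2)
    (hlt : ∀ ξ ∈ Kᗮ, ξ ≠ 0 → x * ‖ξ‖ ^ 2 < a.reApplyInnerSelf ξ) :
    spectralSubspace a x = K := by
  -- Since the two projections commute, the part of a vector of one subspace that is orthogonal to
  -- the other stays in the first. It then obeys both the upper bound and the strict lower bound, so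
  -- it is zero.
  have hc' := commute_starProjection_spectralSubspace ha hc x
  refine le_antisymm (fun ξ hξ => ?_) fun ξ hξ => ?_
  · rw [← Submodule.starProjection_orthogonal_apply_eq_zero_iff]
    by_contra h0
    refine (hlt _ (Kᗮ.starProjection_apply_mem ξ) h0).not_ge
      (reApplyInnerSelf_le_of_mem_spectralSubspace ha ?_)
    rw [Submodule.starProjection_orthogonal_val]
    exact sub_mem hξ (Submodule.apply_mem_of_commute_starProjection hc' hξ)
  · rw [← Submodule.starProjection_orthogonal_apply_eq_zero_iff]
    by_contra h0
    refine (lt_reApplyInnerSelf_of_mem_orthogonal ha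
      ((spectralSubspace a x)ᗮ.starProjection_apply_mem ξ) h0).not_ge (hle _ ?_)
    rw [Submodule.starProjection_orthogonal_val]
    exact sub_mem hξ (Submodule.apply_mem_of_commute_starProjection hc'.symm hξ)

theorem spectralSubspace_mono {a : H →L[ℂ] H} (ha : IsSelfAdjoint a) :
    Monotone (spectralSubspace a) := by
  intro x y hxy ξ hξ
  rw [← Submodule.starProjection_orthogonal_apply_eq_zero_iff]
  by_contra h0
  refine (lt_reApplyInnerSelf_of_mem_orthogonal ha
    ((spectralSubspace a y)ᗮ.starProjection_apply_mem ξ) h0).not_ge ?_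
  refine (reApplyInnerSelf_le_of_mem_spectralSubspace ha (x := x) ?_).trans (by gcongr)
  rw [Submodule.starProjection_orthogonal_val]
  exact sub_mem hξ (apply_mem_spectralSubspace
    (commute_starProjection_spectralSubspace ha (Commute.refl a) y) hξ)

/-- Right continuity: as `y` decreases to `x`, the upper bounds at level `y` contradict the strict
lower bound on the complement at level `x`. -/
theorem mem_spectralSubspace_of_forall_lt {a : H →L[ℂ] H} (ha : IsSelfAdjoint a) {x : ℝ} {ξ : H}
    (h : ∀ y, x < y → ξ ∈ spectralSubspace a y) : ξ ∈ spectralSubspace a x := by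
  rw [← Submodule.starProjection_orthogonal_apply_eq_zero_iff]
  by_contra h0
  refine (lt_reApplyInnerSelf_of_mem_orthogonal ha
    ((spectralSubspace a x)ᗮ.starProjection_apply_mem ξ) h0).not_ge ?_
  set η := (spectralSubspace a x)ᗮ.starProjection ξ with hη
  have h1 : ∀ y, x < y → a.reApplyInnerSelf η ≤ y * ‖η‖ ^ 2 := by
    intro y hy
    refine reApplyInnerSelf_le_of_mem_spectralSubspace ha ?_
    rw [hη, Submodule.starProjection_orthogonal_val]
    exact sub_mem (h y hy) (apply_mem_spectralSubspace
      (commute_starProjection_spectralSubspace ha (Commute.refl a) x) (h y hy))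
  have h2 : 0 < ‖η‖ ^ 2 := by positivity
  rw [← div_le_iff₀ h2]
  exact le_of_forall_gt_imp_ge_of_dense fun y hy => (div_le_iff₀ h2).2 (h1 y hy)

omit [CompleteSpace H] in
theorem abs_reApplyInnerSelf_le (a : H →L[ℂ] H) (ξ : H) :
    |a.reApplyInnerSelf ξ| ≤ ‖a‖ * ‖ξ‖ ^ 2 := by
  rw [ContinuousLinearMap.reApplyInnerSelf_apply]
  calc |RCLike.re (inner ℂ (a ξ) ξ)| ≤ ‖inner ℂ (a ξ) ξ‖ := RCLike.abs_re_le_norm _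
    _ ≤ ‖a ξ‖ * ‖ξ‖ := norm_inner_le_norm _ _
    _ ≤ ‖a‖ * ‖ξ‖ * ‖ξ‖ := by gcongr; exact a.le_opNorm ξ
    _ = ‖a‖ * ‖ξ‖ ^ 2 := by ring

theorem spectralSubspace_eq_bot {a : H →L[ℂ] H} (ha : IsSelfAdjoint a) {x : ℝ} (hx : x < -‖a‖) :
    spectralSubspace a x = ⊥ := by
  rw [eq_bot_iff]
  intro ξ hξ
  have h1 := reApplyInnerSelf_le_of_mem_spectralSubspace ha hξ
  have h2 := neg_le_of_abs_le (abs_reApplyInnerSelf_le a ξ)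
  by_contra h0
  have h3 : 0 < ‖ξ‖ ^ 2 := by have : ξ ≠ 0 := h0; positivity
  nlinarith

theorem spectralSubspace_eq_top {a : H →L[ℂ] H} (ha : IsSelfAdjoint a) {x : ℝ} (hx : ‖a‖ ≤ x) :
    spectralSubspace a x = ⊤ := by
  rw [eq_top_iff]
  intro ξ _
  rw [← Submodule.starProjection_orthogonal_apply_eq_zero_iff]
  by_contra h0
  refine (lt_reApplyInnerSelf_of_mem_orthogonal ha
    ((spectralSubspace a x)ᗮ.starProjection_apply_mem ξ) h0).not_ge ?_
  exact (le_of_abs_le (abs_reApplyInnerSelf_le a _)).trans (by gcongr)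

theorem ContinuousLinearMap.ext_reApplyInnerSelf {a b : H →L[ℂ] H} (ha : IsSelfAdjoint a)
    (hb : IsSelfAdjoint b) (h : ∀ ξ, a.reApplyInnerSelf ξ = b.reApplyInnerSelf ξ) : a = b := by
  have key : ∀ {a b : H →L[ℂ] H}, IsSelfAdjoint a → IsSelfAdjoint b →
      (∀ ξ, a.reApplyInnerSelf ξ = b.reApplyInnerSelf ξ) → a ≤ b := by
    intro a b ha hb h
    rw [ContinuousLinearMap.le_def, ContinuousLinearMap.isPositive_def']
    refine ⟨hb.sub ha, fun ξ => ?_⟩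
    have := h ξ
    simp only [ContinuousLinearMap.reApplyInnerSelf_apply] at this
    simp [ContinuousLinearMap.reApplyInnerSelf_apply, inner_sub_left] at this ⊢
    linarith
  exact le_antisymm (key ha hb h) (key hb ha fun ξ => (h ξ).symm)

/-- On the slice between levels `y` and `y + δ` both forms lie between `y * ‖ξ‖ ^ 2` and `(y + δ) *
‖ξ‖ ^ 2`. The slices reduce both operators, so by Pythagoras the errors over all slices still add up
to at most `δ * ‖ξ‖ ^ 2`. -/
theorem abs_reApplyInnerSelf_sub_le {a b : H →L[ℂ] H} (ha : IsSelfAdjoint a)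
    (hb : IsSelfAdjoint b) (h : spectralSubspace a = spectralSubspace b) {x δ : ℝ}
    (hx : spectralSubspace a x = ⊥) (k : ℕ) :
    ∀ ξ ∈ spectralSubspace a (x + k * δ),
      |a.reApplyInnerSelf ξ - b.reApplyInnerSelf ξ| ≤ δ * ‖ξ‖ ^ 2 := by
  induction k with
  | zero =>
    intro ξ hξ
    rw [Nat.cast_zero, zero_mul, add_zero, hx, Submodule.mem_bot] at hξ
    simp [hξ, ContinuousLinearMap.reApplyInnerSelf_apply]
  | succ k ih =>
    intro ξ hξ
    set y := x + k * δ with hy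
    have hy' : x + ((k + 1 : ℕ) : ℝ) * δ = y + δ := by rw [hy]; push_cast; ring
    rw [hy'] at hξ
    have hca := commute_starProjection_spectralSubspace ha (Commute.refl a) y
    have hcb := commute_starProjection_spectralSubspace hb (Commute.refl b) y
    rw [← Submodule.starProjection_inj.2 (congrFun h y)] at hcb
    rw [Submodule.reApplyInnerSelf_eq_add hca, Submodule.reApplyInnerSelf_eq_add hcb]
    have hn := Submodule.norm_sq_eq_add_norm_sq_starProjection ξ (spectralSubspace a y)
    have h1 := ih _ ((spectralSubspace a y).starProjection_apply_mem ξ)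
    set η := (spectralSubspace a y)ᗮ.starProjection ξ with hη
    have hη1 : η ∈ (spectralSubspace a y)ᗮ := Submodule.starProjection_apply_mem _ _
    have hη2 : η ∈ spectralSubspace a (y + δ) := by
      rw [hη, Submodule.starProjection_orthogonal_val]
      exact sub_mem hξ (apply_mem_spectralSubspace hca hξ)
    have h2 : y * ‖η‖ ^ 2 ≤ a.reApplyInnerSelf η := by
      rcases eq_or_ne η 0 with h0 | h0
      · simp [h0, ContinuousLinearMap.reApplyInnerSelf_apply]
      · exact (lt_reApplyInnerSelf_of_mem_orthogonal ha hη1 h0).le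
    have h3 : y * ‖η‖ ^ 2 ≤ b.reApplyInnerSelf η := by
      rcases eq_or_ne η 0 with h0 | h0
      · simp [h0, ContinuousLinearMap.reApplyInnerSelf_apply]
      · exact (lt_reApplyInnerSelf_of_mem_orthogonal hb (h ▸ hη1) h0).le
    have h4 := reApplyInnerSelf_le_of_mem_spectralSubspace ha hη2
    have h5 := reApplyInnerSelf_le_of_mem_spectralSubspace hb (x := y + δ) (h ▸ hη2)
    rw [hn]
    rw [abs_le] at h1 ⊢
    constructor <;> linarith

/-- A self-adjoint operator is determined by its spectral subspaces. -/
theorem eq_of_spectralSubspace_eq {a b : H →L[ℂ] H} (ha : IsSelfAdjoint a)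
    (hb : IsSelfAdjoint b) (h : spectralSubspace a = spectralSubspace b) : a = b := by
  refine ContinuousLinearMap.ext_reApplyInnerSelf ha hb fun ξ => ?_
  have key : ∀ δ : ℝ, 0 < δ → |a.reApplyInnerSelf ξ - b.reApplyInnerSelf ξ| ≤ δ * ‖ξ‖ ^ 2 := by
    intro δ hδ
    -- Enough slices to climb from `-‖a‖ - 1`, where the subspace is `⊥`, to at least `‖a‖`, where
    -- it is `⊤`.
    obtain ⟨k, hk⟩ := Archimedean.arch (2 * ‖a‖ + 1) hδ
    rw [nsmul_eq_mul] at hk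
    refine abs_reApplyInnerSelf_sub_le ha hb h (x := -‖a‖ - 1)
      (spectralSubspace_eq_bot ha (by linarith)) k ξ ?_
    rw [spectralSubspace_eq_top ha (by linarith)]
    trivial
  rw [← sub_eq_zero, ← abs_nonpos_iff]
  have hlim : Filter.Tendsto (fun δ : ℝ => δ * ‖ξ‖ ^ 2) (nhdsWithin 0 (Set.Ioi 0)) (nhds 0) := by
    have : Continuous fun δ : ℝ => δ * ‖ξ‖ ^ 2 := by fun_prop
    simpa using (this.tendsto 0).mono_left nhdsWithin_le_nhds
  exact ge_of_tendsto hlim (by filter_upwards [self_mem_nhdsWithin] with δ hδ using key δ hδ)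

end SpectralSubspace

/-! ### Operators from spectral families, by dyadic Riemann sums -/

section SpectralIntegral

variable {H : Type*} [NormedAddCommGroup H] [InnerProductSpace ℂ H]

theorem Finset.sum_range_two_mul {M : Type*} [AddCommMonoid M] (f : ℕ → M) (n : ℕ) :
    ∑ k ∈ Finset.range (2 * n), f k = ∑ k ∈ Finset.range n, (f (2 * k) + f (2 * k + 1)) := by
  induction n with
  | zero => simp
  | succ n ih =>
    rw [Finset.sum_range_succ, ← ih, show 2 * (n + 1) = 2 * n + 1 + 1 by ring,
      Finset.sum_range_succ, Finset.sum_range_succ, add_assoc]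

theorem Submodule.commute_starProjection_of_le {K L : Submodule ℂ H} [K.HasOrthogonalProjection]
    [L.HasOrthogonalProjection] (h : K ≤ L) : Commute K.starProjection L.starProjection := by
  have h1 : K.starProjection * L.starProjection = K.starProjection :=
    Submodule.starProjection_comp_starProjection_of_le h
  have h2 : L.starProjection * K.starProjection = K.starProjection :=
    ContinuousLinearMap.ext fun ξ =>
      L.starProjection_eq_self_iff.2 (h (K.starProjection_apply_mem ξ))
  exact h1.trans h2.symm

theorem Submodule.reApplyInnerSelf_starProjection (K : Submodule ℂ H) [K.HasOrthogonalProjection]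
    (ξ : H) : K.starProjection.reApplyInnerSelf ξ = ‖K.starProjection ξ‖ ^ 2 := by
  rw [ContinuousLinearMap.reApplyInnerSelf_apply, ← inner_self_eq_norm_sq (𝕜 := ℂ)]
  conv_rhs => rw [← Submodule.inner_starProjection_left_eq_right,
    Submodule.starProjection_eq_self_iff.2 (K.starProjection_apply_mem ξ)]

variable (E : ℝ → Submodule ℂ H) [∀ x, (E x).HasOrthogonalProjection]

/-- The `n`-th dyadic lower Riemann sum for `∫ (1 - E x) dx` over `[m, m + N]`. -/
noncomputable def riemannSum (m : ℝ) (N n : ℕ) : H →L[ℂ] H :=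
  ∑ k ∈ Finset.range (2 ^ n * N), ((1 / 2 : ℝ) ^ n) • (E (m + k * (1 / 2 : ℝ) ^ n))ᗮ.starProjection

variable {E}

/-- The even nodes of the refined sum are the old nodes and the odd ones are midpoints, so half of
each old term cancels. -/
theorem riemannSum_sub (m : ℝ) (N n : ℕ) :
    riemannSum E m N n - riemannSum E m N (n + 1) =
      ((1 / 2 : ℝ) ^ (n + 1)) • ∑ k ∈ Finset.range (2 ^ n * N),
        ((E (m + k * (1 / 2 : ℝ) ^ n))ᗮ.starProjection -
          (E (m + k * (1 / 2 : ℝ) ^ n + (1 / 2 : ℝ) ^ (n + 1)))ᗮ.starProjection) := by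
  have h2 : ∀ k : ℕ, m + ((2 * k : ℕ) : ℝ) * (1 / 2 : ℝ) ^ (n + 1) = m + k * (1 / 2 : ℝ) ^ n := by
    intro k; push_cast; ring
  have h3 : ∀ k : ℕ, m + ((2 * k + 1 : ℕ) : ℝ) * (1 / 2 : ℝ) ^ (n + 1) =
      m + k * (1 / 2 : ℝ) ^ n + (1 / 2 : ℝ) ^ (n + 1) := by
    intro k; push_cast; ring
  have h4 : (1 / 2 : ℝ) ^ n = (1 / 2 : ℝ) ^ (n + 1) + (1 / 2 : ℝ) ^ (n + 1) := by ring
  rw [riemannSum, riemannSum, pow_succ' 2 n, mul_assoc, Finset.sum_range_two_mul,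
    ← Finset.sum_sub_distrib, Finset.smul_sum]
  refine Finset.sum_congr rfl fun k _ => ?_
  simp only [h2, h3]
  generalize (E (m + k * (1 / 2 : ℝ) ^ n))ᗮ.starProjection = P
  generalize (E (m + k * (1 / 2 : ℝ) ^ n + (1 / 2 : ℝ) ^ (n + 1)))ᗮ.starProjection = Q
  rw [h4]
  module

theorem antitone_starProjection_orthogonal (hE : Monotone E) :
    Antitone fun x => (E x)ᗮ.starProjection := fun _ _ h =>
  Submodule.starProjection_le_starProjection_iff.2 (Submodule.orthogonal_le (hE h))

variable [CompleteSpace H]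

/-- The summands are positive, and each is dominated by the drop over its whole dyadic cell. Those
drops telescope to a difference of two projections, which is at most `1`. -/
theorem norm_sum_starProjection_sub_le (hE : Monotone E) (m : ℝ) (n K : ℕ) :
    ‖∑ k ∈ Finset.range K,
        ((E (m + k * (1 / 2 : ℝ) ^ n))ᗮ.starProjection -
          (E (m + k * (1 / 2 : ℝ) ^ n + (1 / 2 : ℝ) ^ (n + 1)))ᗮ.starProjection)‖ ≤ 1 := by
  have hanti := antitone_starProjection_orthogonal hE
  have h0 : 0 ≤ ∑ k ∈ Finset.range K,
        ((E (m + k * (1 / 2 : ℝ) ^ n))ᗮ.starProjection -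
          (E (m + k * (1 / 2 : ℝ) ^ n + (1 / 2 : ℝ) ^ (n + 1)))ᗮ.starProjection) :=
    Finset.sum_nonneg fun k _ => sub_nonneg.2 (hanti (by simp))
  rw [CStarAlgebra.norm_le_one_iff_of_nonneg _ h0]
  have h1 : ∀ k : ℕ, (E (m + k * (1 / 2 : ℝ) ^ n))ᗮ.starProjection -
          (E (m + k * (1 / 2 : ℝ) ^ n + (1 / 2 : ℝ) ^ (n + 1)))ᗮ.starProjection ≤
        (E (m + k * (1 / 2 : ℝ) ^ n))ᗮ.starProjection -
          (E (m + (k + 1 : ℕ) * (1 / 2 : ℝ) ^ n))ᗮ.starProjection := by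
    intro k
    refine sub_le_sub_left (hanti ?_) _
    have : (0 : ℝ) < (1 / 2) ^ n := by positivity
    push_cast
    rw [pow_succ]
    linarith
  refine (Finset.sum_le_sum fun k _ => h1 k).trans ?_
  rw [Finset.sum_range_sub' fun k : ℕ => (E (m + k * (1 / 2 : ℝ) ^ n))ᗮ.starProjection]
  refine (sub_le_self _ ?_).trans ?_
  · exact ((ContinuousLinearMap.nonneg_iff_isPositive _).2
      (ContinuousLinearMap.IsPositive.of_isStarProjection isStarProjection_starProjection))
  · rw [← Submodule.starProjection_top', Submodule.starProjection_le_starProjection_iff]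
    exact le_top

theorem cauchySeq_riemannSum (hE : Monotone E) (m : ℝ) (N : ℕ) :
    CauchySeq (riemannSum E m N) := by
  refine cauchySeq_of_le_geometric (1 / 2) (1 / 2) (by norm_num) fun n => ?_
  rw [dist_eq_norm, riemannSum_sub, norm_smul, Real.norm_of_nonneg (by positivity)]
  calc _ ≤ (1 / 2 : ℝ) ^ (n + 1) * 1 := by
        gcongr
        exact norm_sum_starProjection_sub_le hE m n _
    _ = _ := by ring

omit [CompleteSpace H] in
theorem reApplyInnerSelf_riemannSum (m : ℝ) (N n : ℕ) (ξ : H) :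
    (riemannSum E m N n).reApplyInnerSelf ξ = ∑ k ∈ Finset.range (2 ^ n * N),
      (1 / 2 : ℝ) ^ n * ‖(E (m + k * (1 / 2 : ℝ) ^ n))ᗮ.starProjection ξ‖ ^ 2 := by
  simp only [← Submodule.reApplyInnerSelf_starProjection]
  simp only [riemannSum, ContinuousLinearMap.reApplyInnerSelf_apply, sum_apply,
    smul_apply, sum_inner, map_sum, inner_smul_left_eq_smul, RCLike.smul_re]

-- Nodes at or above `x` contribute nothing to `ξ`, and at most `⌈(x - m) / δ⌉₊` nodes lie below
-- `x`, where `δ` is the mesh.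
omit [CompleteSpace H] in
theorem reApplyInnerSelf_riemannSum_le (hE : Monotone E) {m x : ℝ} (hx : m ≤ x) (N n : ℕ) {ξ : H}
    (hξ : ξ ∈ E x) :
    (riemannSum E m N n).reApplyInnerSelf ξ ≤ (x - m + (1 / 2 : ℝ) ^ n) * ‖ξ‖ ^ 2 := by
  rw [reApplyInnerSelf_riemannSum]
  set δ : ℝ := (1 / 2) ^ n with hδ
  have hδ0 : 0 < δ := by positivity
  set c := ⌈(x - m) / δ⌉₊ with hc
  have hterm : ∀ k : ℕ, δ * ‖(E (m + k * δ))ᗮ.starProjection ξ‖ ^ 2 ≤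
      if k < c then δ * ‖ξ‖ ^ 2 else 0 := by
    intro k
    split_ifs with hk
    · gcongr
      exact Submodule.norm_starProjection_apply_le _ _
    · rw [Submodule.starProjection_orthogonal_apply_eq_zero_iff.2]
      · simp
      · refine hE ?_ hξ
        rw [not_lt, hc, Nat.ceil_le, div_le_iff₀ hδ0] at hk
        linarith
  calc _ ≤ ∑ k ∈ Finset.range (2 ^ n * N), if k < c then δ * ‖ξ‖ ^ 2 else 0 :=
        Finset.sum_le_sum fun k _ => hterm k
    _ = ∑ k ∈ Finset.range (2 ^ n * N) with k < c, δ * ‖ξ‖ ^ 2 := by rw [Finset.sum_filter]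
    _ ≤ ∑ k ∈ Finset.range c, δ * ‖ξ‖ ^ 2 := by
        refine Finset.sum_le_sum_of_subset_of_nonneg (fun k hk => ?_) fun _ _ _ => by positivity
        simp only [Finset.mem_filter] at hk
        simpa using hk.2
    _ = c * δ * ‖ξ‖ ^ 2 := by rw [Finset.sum_const, Finset.card_range, nsmul_eq_mul]; ring
    _ ≤ ((x - m) / δ + 1) * δ * ‖ξ‖ ^ 2 := by
        gcongr
        exact (Nat.ceil_lt_add_one (div_nonneg (by linarith) hδ0.le)).le
    _ = (x - m + δ) * ‖ξ‖ ^ 2 := by field_simp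

-- Every node below `x` contributes its full `δ * ‖ξ‖ ^ 2`; the bound `x ≤ m + N` ensures that all
-- of these nodes are summed.
omit [CompleteSpace H] in
theorem le_reApplyInnerSelf_riemannSum (hE : Monotone E) {m x : ℝ} {N : ℕ} (hx : x ≤ m + N)
    (n : ℕ) {ξ : H} (hξ : ξ ∈ (E x)ᗮ) :
    (x - m) * ‖ξ‖ ^ 2 ≤ (riemannSum E m N n).reApplyInnerSelf ξ := by
  rw [reApplyInnerSelf_riemannSum]
  set δ : ℝ := (1 / 2) ^ n with hδ
  have hδ0 : 0 < δ := by positivity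
  have hδ1 : δ * 2 ^ n = 1 := by rw [hδ, ← mul_pow]; norm_num
  set c := ⌈(x - m) / δ⌉₊ with hc
  calc (x - m) * ‖ξ‖ ^ 2 = (x - m) / δ * δ * ‖ξ‖ ^ 2 := by field_simp
    _ ≤ c * δ * ‖ξ‖ ^ 2 := by gcongr; exact Nat.le_ceil _
    _ = ∑ k ∈ Finset.range c, δ * ‖ξ‖ ^ 2 := by
        rw [Finset.sum_const, Finset.card_range, nsmul_eq_mul]; ring
    _ = ∑ k ∈ Finset.range c, δ * ‖(E (m + k * δ))ᗮ.starProjection ξ‖ ^ 2 := by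
        refine Finset.sum_congr rfl fun k hk => ?_
        rw [Finset.mem_range, hc, Nat.lt_ceil, lt_div_iff₀ hδ0] at hk
        rw [(Submodule.starProjection_eq_self_iff (K := (E (m + k * δ))ᗮ)).2]
        exact Submodule.orthogonal_le (hE (by linarith)) hξ
    _ ≤ _ := by
        refine Finset.sum_le_sum_of_subset_of_nonneg ?_ fun _ _ _ => by positivity
        refine Finset.range_mono ?_
        rw [hc, Nat.ceil_le, div_le_iff₀ hδ0]
        push_cast
        nlinarith

omit [CompleteSpace H] in
theorem riemannSum_mem (B : Subalgebra ℂ (H →L[ℂ] H))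
    (hB : ∀ x, (E x).starProjection ∈ B) (m : ℝ) (N n : ℕ) : riemannSum E m N n ∈ B := by
  refine sum_mem fun k _ => ?_
  rw [RCLike.real_smul_eq_coe_smul (K := ℂ), Submodule.starProjection_orthogonal']
  exact B.smul_mem (sub_mem (one_mem B) (hB _)) _

omit [CompleteSpace H] in
theorem continuous_reApplyInnerSelf_left (ξ : H) :
    Continuous fun a : H →L[ℂ] H => a.reApplyInnerSelf ξ := by
  simp only [ContinuousLinearMap.reApplyInnerSelf_apply]
  fun_prop

theorem isSelfAdjoint_riemannSum (m : ℝ) (N n : ℕ) : IsSelfAdjoint (riemannSum E m N n) :=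
  isSelfAdjoint_sum _ fun _ _ => (IsSelfAdjoint.all _).smul isStarProjection_starProjection.2

/-- A bounded, monotone and right-continuous family of closed subspaces is the family of spectral
subspaces of a self-adjoint operator. -/
theorem exists_spectralSubspace_eq (hE : Monotone E)
    (hright : ∀ x ξ, (∀ y, x < y → ξ ∈ E y) → ξ ∈ E x) {m M : ℝ}
    (hm : ∀ x < m, E x = ⊥) (hM : ∀ x, M ≤ x → E x = ⊤) :
    ∃ a : H →L[ℂ] H, IsSelfAdjoint a ∧ (∀ x, spectralSubspace a x = E x) ∧
      ∀ B : Subalgebra ℂ (H →L[ℂ] H), IsClosed (B : Set (H →L[ℂ] H)) →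
        (∀ x, (E x).starProjection ∈ B) → a ∈ B := by
  obtain ⟨N, hN⟩ := exists_nat_ge (M - m)
  obtain ⟨s, hs⟩ := cauchySeq_tendsto_of_complete (cauchySeq_riemannSum hE m N)
  have hmem : ∀ B : Subalgebra ℂ (H →L[ℂ] H), IsClosed (B : Set (H →L[ℂ] H)) →
        (∀ x, (E x).starProjection ∈ B) → algebraMap ℝ (H →L[ℂ] H) m + s ∈ B := by
    intro B hB h
    refine add_mem ?_ (hB.mem_of_tendsto hs (.of_forall fun n => riemannSum_mem B h m N n))
    rw [Algebra.algebraMap_eq_smul_one, RCLike.real_smul_eq_coe_smul (K := ℂ)]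
    exact B.smul_mem (one_mem B) _
  have hre : ∀ ξ, (algebraMap ℝ (H →L[ℂ] H) m + s).reApplyInnerSelf ξ =
      m * ‖ξ‖ ^ 2 + s.reApplyInnerSelf ξ := by
    intro ξ
    have := ContinuousLinearMap.reApplyInnerSelf_add_sub (algebraMap ℝ (H →L[ℂ] H) m) s 0 ξ
    rw [sub_zero, reApplyInnerSelf_algebraMap] at this
    simpa [ContinuousLinearMap.reApplyInnerSelf_apply] using this
  have hlim : ∀ ξ, Filter.Tendsto (fun n => (riemannSum E m N n).reApplyInnerSelf ξ) Filter.atTop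
      (nhds (s.reApplyInnerSelf ξ)) := fun ξ =>
    ((continuous_reApplyInnerSelf_left ξ).tendsto s).comp hs
  have hcomm : ∀ x, Commute (algebraMap ℝ (H →L[ℂ] H) m + s) (E x).starProjection := by
    intro x
    -- A centralizer is a closed subalgebra, and the nested projections commute, so the membership
    -- clause itself yields the commutation.
    have := hmem (Subalgebra.centralizer ℂ {(E x).starProjection})
      (Set.isClosed_centralizer _) fun y => by
        rw [Subalgebra.mem_centralizer_iff]
        rintro _ rfl
        rcases le_total x y with h | h
        · exact Submodule.commute_starProjection_of_le (hE h)
        · exact (Submodule.commute_starProjection_of_le (hE h)).symm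
    exact (Subalgebra.mem_centralizer_iff ℂ |>.1 this _ rfl).symm
  have hsa : IsSelfAdjoint (algebraMap ℝ (H →L[ℂ] H) m + s) := by
    refine ((IsSelfAdjoint.all m).algebraMap _).add ?_
    exact (isClosed_eq continuous_star continuous_id).mem_of_tendsto hs
      (.of_forall fun n => isSelfAdjoint_riemannSum m N n)
  have hle : ∀ x, ∀ ξ ∈ E x,
      (algebraMap ℝ (H →L[ℂ] H) m + s).reApplyInnerSelf ξ ≤ x * ‖ξ‖ ^ 2 := by
    intro x ξ hξ
    rcases lt_or_ge x m with hx | hx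
    · rw [hm x hx, Submodule.mem_bot] at hξ
      simp [hξ, ContinuousLinearMap.reApplyInnerSelf_apply]
    · have h1 : Filter.Tendsto (fun n : ℕ => (x - m + (1 / 2 : ℝ) ^ n) * ‖ξ‖ ^ 2) Filter.atTop
          (nhds ((x - m + 0) * ‖ξ‖ ^ 2)) :=
        ((tendsto_pow_atTop_nhds_zero_of_lt_one (by norm_num) (by norm_num)).const_add _).mul_const _
      have h2 := le_of_tendsto_of_tendsto' (hlim ξ) h1
        fun n => reApplyInnerSelf_riemannSum_le hE hx N n hξ
      rw [hre]
      linarith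
  have hge : ∀ x, ∀ ξ ∈ (E x)ᗮ,
      x * ‖ξ‖ ^ 2 ≤ (algebraMap ℝ (H →L[ℂ] H) m + s).reApplyInnerSelf ξ := by
    intro x ξ hξ
    rcases le_or_gt M x with hx | hx
    · rw [hM x hx, Submodule.top_orthogonal_eq_bot, Submodule.mem_bot] at hξ
      simp [hξ, ContinuousLinearMap.reApplyInnerSelf_apply]
    · have h2 := ge_of_tendsto' (hlim ξ)
        fun n => le_reApplyInnerSelf_riemannSum hE (show x ≤ m + N by linarith) n hξ
      rw [hre]
      linarith
  refine ⟨algebraMap ℝ (H →L[ℂ] H) m + s, hsa, fun x => ?_, hmem⟩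
  refine spectralSubspace_eq hsa (hcomm x) (hle x) fun ξ hξ h0 => ?_
  -- The limit gives only weak lower bounds. Right continuity supplies a level `y > x` beyond which
  -- `ξ` has a nonzero component `v`, and the bound at `y` gains `(y - x) * ‖v‖ ^ 2`.
  obtain ⟨y, hy, hyξ⟩ : ∃ y, x < y ∧ ξ ∉ E y := by
    by_contra! h
    exact h0 (inner_self_eq_zero.1 (Submodule.inner_right_of_mem_orthogonal (hright x ξ h) hξ))
  set u := (E y).starProjection ξ with hu
  set v := (E y)ᗮ.starProjection ξ with hv
  have hv0 : v ≠ 0 := fun h => hyξ (Submodule.starProjection_orthogonal_apply_eq_zero_iff.1 h)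
  have hvy : v ∈ (E y)ᗮ := Submodule.starProjection_apply_mem _ _
  have hux : u ∈ (E x)ᗮ := by
    rw [show u = ξ - v by rw [hv, Submodule.starProjection_orthogonal_val, sub_sub_cancel]]
    exact sub_mem hξ (Submodule.orthogonal_le (hE hy.le) hvy)
  rw [Submodule.reApplyInnerSelf_eq_add (hcomm y),
    Submodule.norm_sq_eq_add_norm_sq_starProjection ξ (E y)]
  have h1 := hge x u hux
  have h2 := hge y v hvy
  have h3 : 0 < ‖v‖ ^ 2 := by positivity
  have h4 : x * ‖v‖ ^ 2 < y * ‖v‖ ^ 2 := by gcongr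
  linarith

end SpectralIntegral

/-! ### Existence of the meets and joins -/

section Daseinisation

variable {H : Type*} [NormedAddCommGroup H] [InnerProductSpace ℂ H]

theorem Submodule.isClosed_of_hasOrthogonalProjection (K : Submodule ℂ H)
    [K.HasOrthogonalProjection] : IsClosed (K : Set H) := by
  rw [← Submodule.orthogonal_orthogonal K]
  exact Submodule.isClosed_orthogonal _

/-- The double complement plays the role of the closed span. It is built only from complements and
infima, under which the projections of a von Neumann algebra are closed. -/
theorem Submodule.orthogonal_iInf_orthogonal_le {ι : Sort*} {K : ι → Submodule ℂ H}
    {L : Submodule ℂ H} [L.HasOrthogonalProjection] (h : ∀ i, K i ≤ L) :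
    (⨅ i, (K i)ᗮ)ᗮ ≤ L := by
  rw [← Submodule.orthogonal_orthogonal L]
  exact Submodule.orthogonal_le (le_iInf fun i => Submodule.orthogonal_le (h i))

theorem Submodule.le_orthogonal_iInf_orthogonal {ι : Sort*} (K : ι → Submodule ℂ H) (i : ι) :
    K i ≤ (⨅ i, (K i)ᗮ)ᗮ :=
  (Submodule.le_orthogonal_orthogonal _).trans (Submodule.orthogonal_le (iInf_le _ i))

variable [CompleteSpace H]

instance Submodule.hasOrthogonalProjection_iInf {ι : Sort*} (K : ι → Submodule ℂ H)
    [∀ i, (K i).HasOrthogonalProjection] : (⨅ i, K i).HasOrthogonalProjection := by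
  have : IsClosed ((⨅ i, K i : Submodule ℂ H) : Set H) := by
    rw [Submodule.coe_iInf]
    exact isClosed_iInter fun i => (K i).isClosed_of_hasOrthogonalProjection
  have := this.completeSpace_coe
  infer_instance

namespace VonNeumannAlgebra

theorem isClosed (A : VonNeumannAlgebra H) : IsClosed (A : Set (H →L[ℂ] H)) := by
  rw [← A.centralizer_centralizer]
  exact Set.isClosed_centralizer _

/-- By the bicommutant property, membership becomes invariance under the commutant, which visibly
passes to infima and kernels. -/
theorem starProjection_mem_iff {A : VonNeumannAlgebra H} {K : Submodule ℂ H}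
    [K.HasOrthogonalProjection] :
    K.starProjection ∈ A ↔ ∀ T ∈ A.commutant, ∀ ξ ∈ K, T ξ ∈ K := by
  rw [IsStarProjection.mem_iff isStarProjection_starProjection]
  simp [Module.End.mem_invtSubmodule_iff_forall_mem_of_mem]

theorem starProjection_orthogonal_mem {A : VonNeumannAlgebra H} {K : Submodule ℂ H}
    [K.HasOrthogonalProjection] (h : K.starProjection ∈ A) : Kᗮ.starProjection ∈ A := by
  rw [Submodule.starProjection_orthogonal']
  exact sub_mem (one_mem A) h

theorem starProjection_iInf_mem {A : VonNeumannAlgebra H} {ι : Sort*} {K : ι → Submodule ℂ H}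
    [∀ i, (K i).HasOrthogonalProjection] (h : ∀ i, (K i).starProjection ∈ A) :
    (⨅ i, K i).starProjection ∈ A := by
  rw [starProjection_mem_iff]
  intro T hT ξ hξ
  rw [Submodule.mem_iInf] at hξ ⊢
  exact fun i => starProjection_mem_iff.1 (h i) T hT ξ (hξ i)

theorem starProjection_ker_mem {A : VonNeumannAlgebra H} {b : H →L[ℂ] H} (hb : b ∈ A)
    [b.ker.HasOrthogonalProjection] : b.ker.starProjection ∈ A := by
  rw [starProjection_mem_iff]
  intro T hT ξ hξ
  have h1 : b ξ = 0 := hξ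
  have h2 : b (T ξ) = T (b ξ) := congrArg (fun S : H →L[ℂ] H => S ξ) (mem_commutant_iff.1 hT b hb)
  rw [h1, map_zero] at h2
  exact h2

theorem cfc_mem {A : VonNeumannAlgebra H} {a : H →L[ℂ] H} (ha : a ∈ A) (f : ℝ → ℝ) :
    cfc f a ∈ A := by
  rw [← A.commutant_commutant, mem_commutant_iff]
  intro T hT
  exact (Commute.cfc_real (mem_commutant_iff.1 hT a ha) f).eq.symm

theorem spectralSubspace_mem {A : VonNeumannAlgebra H} {a : H →L[ℂ] H} (ha : a ∈ A) (x : ℝ) :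
    (spectralSubspace a x).starProjection ∈ A :=
  starProjection_ker_mem (cfc_mem ha _)

theorem algebraMap_mem (A : VonNeumannAlgebra H) (x : ℝ) : algebraMap ℝ (H →L[ℂ] H) x ∈ A := by
  rw [Algebra.algebraMap_eq_smul_one, RCLike.real_smul_eq_coe_smul (K := ℂ)]
  exact A.toStarSubalgebra.smul_mem (one_mem A.toStarSubalgebra) _

end VonNeumannAlgebra

theorem spectralSubspace_algebraMap_of_lt {x y : ℝ} (h : x < y) :
    spectralSubspace (algebraMap ℝ (H →L[ℂ] H) y) x = ⊥ := by
  rw [eq_bot_iff]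
  intro ξ hξ
  have h1 := reApplyInnerSelf_le_of_mem_spectralSubspace
    ((IsSelfAdjoint.all y).algebraMap (H →L[ℂ] H)) hξ
  rw [reApplyInnerSelf_algebraMap] at h1
  by_contra h0
  have h3 : 0 < ‖ξ‖ ^ 2 := by have : ξ ≠ 0 := h0; positivity
  nlinarith

theorem spectralSubspace_algebraMap_of_le {x y : ℝ} (h : y ≤ x) :
    spectralSubspace (algebraMap ℝ (H →L[ℂ] H) y) x = ⊤ := by
  rw [eq_top_iff]
  intro ξ _
  rw [← Submodule.starProjection_orthogonal_apply_eq_zero_iff]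
  by_contra h0
  have h1 := lt_reApplyInnerSelf_of_mem_orthogonal
    ((IsSelfAdjoint.all y).algebraMap (H →L[ℂ] H)) (Submodule.starProjection_apply_mem _ ξ) h0
  rw [reApplyInnerSelf_algebraMap] at h1
  refine h1.not_ge (by gcongr)

variable {A : VonNeumannAlgebra H}

namespace SelfAdjointPart

theorem le_iff {a b : SelfAdjointPart A} :
    a ≤ b ↔ ∀ x, spectralSubspace b.val x ≤ spectralSubspace a.val x :=
  forall_congr' fun _ => spectralProjection_le_iff

/-- Antisymmetry of the spectral order is the uniqueness half of the spectral theorem; it makes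
meets and joins unique. -/
theorem eq_of_le_of_le {a b : SelfAdjointPart A} (h : a ≤ b) (h' : b ≤ a) : a = b :=
  SelfAdjointPart.ext (eq_of_spectralSubspace_eq a.isSelfAdjoint b.isSelfAdjoint
    (funext fun x => le_antisymm (le_iff.1 h' x) (le_iff.1 h x)))

/-- The real scalar `x` as a self-adjoint element. -/
noncomputable def scalar (A : VonNeumannAlgebra H) (x : ℝ) : SelfAdjointPart A where
  val := algebraMap ℝ _ x
  mem := A.algebraMap_mem x
  isSelfAdjoint := (IsSelfAdjoint.all x).algebraMap _

theorem le_scalar (a : SelfAdjointPart A) : a ≤ scalar A ‖a.val‖ := by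
  rw [le_iff]
  intro x
  rcases lt_or_ge x ‖a.val‖ with h | h
  · exact (spectralSubspace_algebraMap_of_lt h).trans_le bot_le
  · exact le_top.trans (spectralSubspace_eq_top a.isSelfAdjoint h).ge

theorem scalar_le (a : SelfAdjointPart A) : scalar A (-‖a.val‖) ≤ a := by
  rw [le_iff]
  intro x
  rcases lt_or_ge x (-‖a.val‖) with h | h
  · exact (spectralSubspace_eq_bot a.isSelfAdjoint h).trans_le bot_le
  · exact le_top.trans (spectralSubspace_algebraMap_of_le h).ge

/-- Construction of an element of `B_sa`, for a von Neumann subalgebra `B` of `A`, from its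
spectral family. -/
theorem exists_spectralSubspace_eq {B : VonNeumannAlgebra H} (hBA : B ≤ A)
    {E : ℝ → Submodule ℂ H} [∀ x, (E x).HasOrthogonalProjection]
    (hB : ∀ x, (E x).starProjection ∈ B) (hE : Monotone E)
    (hright : ∀ x ξ, (∀ y, x < y → ξ ∈ E y) → ξ ∈ E x) {m M : ℝ}
    (hm : ∀ x < m, E x = ⊥) (hM : ∀ x, M ≤ x → E x = ⊤) :
    ∃ d : SelfAdjointPart A, d.val ∈ B ∧ ∀ x, spectralSubspace d.val x = E x := by
  obtain ⟨d, hd, hdE, hmem⟩ := _root_.exists_spectralSubspace_eq hE hright hm hM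
  have hdB : d ∈ B := hmem B.toStarSubalgebra.toSubalgebra B.isClosed hB
  exact ⟨⟨d, hBA hdB, hd⟩, hdB, hdE⟩

end SelfAdjointPart

namespace Context

open SelfAdjointPart

/-- The order reverses spectral subspaces, so the join is given by pointwise intersection, which
preserves right continuity. The member `-‖a‖` bounds the family from one side, and `a` from the
other. -/
theorem exists_isLUB_below (C : Context A) (a : SelfAdjointPart A) :
    ∃ d, IsLUB (C.below a) d ∧ d.val ∈ C.algebra := by
  have hne : scalar A (-‖a.val‖) ∈ C.below a := ⟨C.algebra.algebraMap_mem _, scalar_le a⟩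
  obtain ⟨d, hdC, hd⟩ := SelfAdjointPart.exists_spectralSubspace_eq C.le
    (E := fun x => ⨅ b : C.below a, spectralSubspace b.1.val x) (m := -‖a.val‖) (M := ‖a.val‖)
    (fun x => VonNeumannAlgebra.starProjection_iInf_mem fun b =>
      VonNeumannAlgebra.spectralSubspace_mem b.2.1 x)
    (fun x y hxy => iInf_mono fun b => spectralSubspace_mono b.1.isSelfAdjoint hxy)
    (fun x ξ h => by
      rw [Submodule.mem_iInf]
      exact fun b => mem_spectralSubspace_of_forall_lt b.1.isSelfAdjoint fun y hy =>
        Submodule.mem_iInf _ |>.1 (h y hy) b)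
    (fun x hx => eq_bot_iff.2 ((iInf_le _ ⟨_, hne⟩).trans
      (spectralSubspace_algebraMap_of_lt hx).le))
    (fun x hx => eq_top_iff.2 (le_iInf fun b =>
      (spectralSubspace_eq_top a.isSelfAdjoint hx).ge.trans (le_iff.1 b.2.2 x)))
  refine ⟨d, ⟨fun b hb => ?_, fun c hc => ?_⟩, hdC⟩
  · rw [le_iff]
    intro x
    rw [hd]
    exact iInf_le (fun b : C.below a => spectralSubspace b.1.val x) ⟨b, hb⟩
  · rw [le_iff]
    intro x
    rw [hd]
    exact le_iInf fun b => le_iff.1 (hc b.2) x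

theorem exists_isGLB_above (C : Context A) (a : SelfAdjointPart A) :
    ∃ d, IsGLB (C.above a) d ∧ d.val ∈ C.algebra := by
  have hne : scalar A ‖a.val‖ ∈ C.above a := ⟨C.algebra.algebraMap_mem _, le_scalar a⟩
  -- The meet calls for pointwise closed spans. These need not be right-continuous, so the spectral
  -- family used is the intersection of `G y` over `y > x`; lower bounds survive because their own
  -- families are right-continuous.
  let G : ℝ → Submodule ℂ H := fun y => (⨅ b : C.above a, (spectralSubspace b.1.val y)ᗮ)ᗮ
  have hG : ∀ y, (G y).starProjection ∈ C.algebra := fun y =>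
    VonNeumannAlgebra.starProjection_orthogonal_mem <|
      VonNeumannAlgebra.starProjection_iInf_mem fun b =>
        VonNeumannAlgebra.starProjection_orthogonal_mem <|
          VonNeumannAlgebra.spectralSubspace_mem b.2.1 y
  have hGb : ∀ (b : C.above a) y, spectralSubspace b.1.val y ≤ G y := fun b y =>
    Submodule.le_orthogonal_iInf_orthogonal (fun b : C.above a => spectralSubspace b.1.val y) b
  have hGc : ∀ {c : SelfAdjointPart A}, c ∈ lowerBounds (C.above a) →
      ∀ y, G y ≤ spectralSubspace c.val y := fun hc y =>
    Submodule.orthogonal_iInf_orthogonal_le fun b : C.above a => le_iff.1 (hc b.2) y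
  obtain ⟨d, hdC, hd⟩ := SelfAdjointPart.exists_spectralSubspace_eq C.le
    (E := fun x => ⨅ y : Set.Ioi x, G y) (m := -‖a.val‖) (M := ‖a.val‖)
    (fun x => VonNeumannAlgebra.starProjection_iInf_mem fun y => hG y)
    (fun x x' hx => le_iInf fun y => iInf_le (fun y : Set.Ioi x => G y) ⟨y, hx.trans_lt y.2⟩)
    (fun x ξ h => by
      rw [Submodule.mem_iInf]
      rintro ⟨z, hz⟩
      obtain ⟨y, hxy, hyz⟩ := exists_between (Set.mem_Ioi.1 hz)
      exact Submodule.mem_iInf _ |>.1 (h y hxy) ⟨z, hyz⟩)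
    (fun x hx => by
      -- The regularised family at `x` only sees levels above `x`, so a level still below `-‖a‖` is
      -- needed. There `G` lies inside the subspace of `a`, itself a lower bound.
      obtain ⟨y, hxy, hy⟩ := exists_between hx
      rw [eq_bot_iff, ← spectralSubspace_eq_bot a.isSelfAdjoint hy]
      exact (iInf_le (fun y : Set.Ioi x => G y) ⟨y, hxy⟩).trans (hGc (fun b hb => hb.2) y))
    (fun x hx => eq_top_iff.2 (le_iInf fun y =>
      (spectralSubspace_algebraMap_of_le (hx.trans (le_of_lt y.2))).ge.trans (hGb ⟨_, hne⟩ y)))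
  refine ⟨d, ⟨fun b hb => ?_, fun c hc => ?_⟩, hdC⟩
  · rw [le_iff]
    intro x
    rw [hd]
    exact le_iInf fun y =>
      (spectralSubspace_mono b.isSelfAdjoint (le_of_lt y.2)).trans (hGb ⟨b, hb⟩ y)
  · rw [le_iff]
    intro x ξ hξ
    rw [hd, Submodule.mem_iInf] at hξ
    exact mem_spectralSubspace_of_forall_lt c.isSelfAdjoint fun y hy => hGc hc y (hξ ⟨y, hy⟩)

theorem isGLB_outerDaseinisation (C : Context A) (a : SelfAdjointPart A) :
    IsGLB (C.above a) (outerDaseinisation a C) := by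
  have h : ∃ d, IsGLB (C.above a) d := (C.exists_isGLB_above a).imp fun _ => And.left
  rw [outerDaseinisation, dif_pos h]
  exact h.choose_spec

theorem isLUB_innerDaseinisation (C : Context A) (a : SelfAdjointPart A) :
    IsLUB (C.below a) (innerDaseinisation a C) := by
  have h : ∃ d, IsLUB (C.below a) d := (C.exists_isLUB_below a).imp fun _ => And.left
  rw [innerDaseinisation, dif_pos h]
  exact h.choose_spec

theorem eq_of_isGLB {s : Set (SelfAdjointPart A)} {c d : SelfAdjointPart A} (hc : IsGLB s c)
    (hd : IsGLB s d) : c = d :=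
  eq_of_le_of_le (hd.2 hc.1) (hc.2 hd.1)

theorem eq_of_isLUB {s : Set (SelfAdjointPart A)} {c d : SelfAdjointPart A} (hc : IsLUB s c)
    (hd : IsLUB s d) : c = d :=
  eq_of_le_of_le (hc.2 hd.1) (hd.2 hc.1)

theorem outerDaseinisation_mem (C : Context A) (a : SelfAdjointPart A) :
    (outerDaseinisation a C).val ∈ C.algebra := by
  obtain ⟨d, hd, hdC⟩ := C.exists_isGLB_above a
  rwa [eq_of_isGLB (C.isGLB_outerDaseinisation a) hd]

theorem innerDaseinisation_mem (C : Context A) (a : SelfAdjointPart A) :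
    (innerDaseinisation a C).val ∈ C.algebra := by
  obtain ⟨d, hd, hdC⟩ := C.exists_isLUB_below a
  rwa [eq_of_isLUB (C.isLUB_innerDaseinisation a) hd]

end Context

end Daseinisation

/-! ### Automorphisms preserve spectral projections and the spectral order -/

section Automorphism

variable {H : Type*} [NormedAddCommGroup H] [InnerProductSpace ℂ H]

theorem Submodule.starProjection_mul_eq_iff {K : Submodule ℂ H} [K.HasOrthogonalProjection]
    {T : H →L[ℂ] H} : K.starProjection * T = T ↔ ∀ ξ, T ξ ∈ K := by
  simp only [ContinuousLinearMap.ext_iff, mul_apply_eq_comp, Submodule.starProjection_eq_self_iff]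

theorem ContinuousLinearMap.mul_starProjection_eq_zero_iff {K : Submodule ℂ H}
    [K.HasOrthogonalProjection] {b : H →L[ℂ] H} : b * K.starProjection = 0 ↔ K ≤ b.ker := by
  refine ⟨fun h ξ hξ => ?_, fun h => ContinuousLinearMap.ext fun ξ =>
    h (K.starProjection_apply_mem ξ)⟩
  have h1 : b (K.starProjection ξ) = 0 := congrArg (fun S : H →L[ℂ] H => S ξ) h
  rwa [K.starProjection_eq_self_iff.2 hξ] at h1

theorem Submodule.le_iff_starProjection_mul {K L : Submodule ℂ H} [K.HasOrthogonalProjection]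
    [L.HasOrthogonalProjection] : K ≤ L ↔ L.starProjection * K.starProjection = K.starProjection := by
  rw [Submodule.starProjection_mul_eq_iff]
  refine ⟨fun h ξ => h (K.starProjection_apply_mem ξ), fun h ξ hξ => ?_⟩
  simpa [K.starProjection_eq_self_iff.2 hξ] using h ξ

variable [CompleteSpace H] {A : VonNeumannAlgebra H}

namespace VonNeumannAlgebra

noncomputable instance (A : VonNeumannAlgebra H) : CStarAlgebra A.toStarSubalgebra :=
  have : IsClosed (A.toStarSubalgebra : Set (H →L[ℂ] H)) := A.isClosed
  StarSubalgebra.cstarAlgebra A.toStarSubalgebra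

variable (h : A.toStarSubalgebra ≃⋆ₐ[ℂ] A.toStarSubalgebra)

theorem isometry_starAlgEquiv : Isometry h := StarAlgEquiv.isometry h

/-- `h` acts only on `A`, so the calculus must be moved from the bounded operators into `A` before
`h` can be applied. -/
theorem coe_cfc {a : A.toStarSubalgebra} (ha : IsSelfAdjoint a) {f : ℝ → ℝ} (hf : Continuous f) :
    ((cfc f a : A.toStarSubalgebra) : H →L[ℂ] H) = cfc f (a : H →L[ℂ] H) :=
  StarAlgHom.map_cfc A.toStarSubalgebra.subtype f a hf.continuousOn continuous_subtype_val ha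
    (ha.map A.toStarSubalgebra.subtype)

theorem coe_map_cfc {a : A.toStarSubalgebra} (ha : IsSelfAdjoint a) {f : ℝ → ℝ}
    (hf : Continuous f) :
    (h ⟨cfc f (a : H →L[ℂ] H), cfc_mem a.2 f⟩ : H →L[ℂ] H) = cfc f (h a : H →L[ℂ] H) := by
  have h1 : (⟨cfc f (a : H →L[ℂ] H), cfc_mem a.2 f⟩ : A.toStarSubalgebra) = cfc f a :=
    Subtype.ext (coe_cfc ha hf).symm
  rw [h1, ← coe_cfc (ha.map h) hf]
  congr 1
  exact StarAlgHomClass.map_cfc (S := ℂ) h f a hf.continuousOn (isometry_starAlgEquiv h).continuous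
    ha (ha.map h)

theorem exists_map_eq_starProjection {p : A.toStarSubalgebra}
    (hp : IsStarProjection (p : H →L[ℂ] H)) :
    ∃ (K : Submodule ℂ H) (_ : K.HasOrthogonalProjection),
      (h p : H →L[ℂ] H) = K.starProjection := by
  rw [← isStarProjection_iff_eq_starProjection]
  have h0 : IsStarProjection p := ⟨Subtype.ext hp.1, Subtype.ext hp.2⟩
  have h1 : IsStarProjection (h p) := h0.map h
  exact ⟨congrArg Subtype.val h1.1, congrArg Subtype.val h1.2⟩

/-- Both projections are the largest ones annihilated by their operator on the left. The kernel
projection `q` of `h b` pulls back to an element killed by `b`, hence absorbed by `p`; so `h p`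
absorbs `q`, and `h b * h p = 0` gives the converse. -/
theorem map_starProjection_ker {b : A.toStarSubalgebra}
    [(b : H →L[ℂ] H).ker.HasOrthogonalProjection]
    [(h b : H →L[ℂ] H).ker.HasOrthogonalProjection] :
    (h ⟨(b : H →L[ℂ] H).ker.starProjection, starProjection_ker_mem b.2⟩ : H →L[ℂ] H) =
      (h b : H →L[ℂ] H).ker.starProjection := by
  set p : A.toStarSubalgebra := ⟨(b : H →L[ℂ] H).ker.starProjection, starProjection_ker_mem b.2⟩
    with hp
  obtain ⟨K, hK, hpK⟩ := exists_map_eq_starProjection h (p := p) isStarProjection_starProjection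
  have hbp : b * p = 0 := Subtype.ext (ContinuousLinearMap.mul_starProjection_eq_zero_iff.2 le_rfl)
  set q : A.toStarSubalgebra := ⟨(h b : H →L[ℂ] H).ker.starProjection,
    starProjection_ker_mem (h b).2⟩ with hq
  have hbq : h b * q = 0 :=
    Subtype.ext (ContinuousLinearMap.mul_starProjection_eq_zero_iff.2 le_rfl)
  have hbq' : b * h.symm q = 0 := by
    apply EquivLike.injective h
    rw [map_mul, map_zero, StarAlgEquiv.apply_symm_apply, hbq]
  have hpq : p * h.symm q = h.symm q := by
    refine Subtype.ext (Submodule.starProjection_mul_eq_iff.2 fun ξ => ?_)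
    exact congrArg (fun S : A.toStarSubalgebra => (S : H →L[ℂ] H) ξ) hbq'
  have hpq' : h p * q = q := by
    have := congrArg h hpq
    rwa [map_mul, StarAlgEquiv.apply_symm_apply] at this
  rw [hpK, Submodule.starProjection_inj]
  refine le_antisymm ?_ ?_
  · rw [← ContinuousLinearMap.mul_starProjection_eq_zero_iff, ← hpK]
    have := congrArg h hbp
    rw [map_mul, map_zero] at this
    exact congrArg Subtype.val this
  · rw [Submodule.le_iff_starProjection_mul, ← hpK]
    exact congrArg Subtype.val hpq'

theorem map_spectralProjection {a : A.toStarSubalgebra} (ha : IsSelfAdjoint a) (x : ℝ) :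
    (h ⟨spectralProjection (a : H →L[ℂ] H) x, spectralSubspace_mem a.2 x⟩ : H →L[ℂ] H) =
      spectralProjection (h a : H →L[ℂ] H) x := by
  have hf : Continuous fun t : ℝ => max (t - x) 0 := by fun_prop
  have h1 := map_starProjection_ker h
    (b := ⟨cfc (fun t : ℝ => max (t - x) 0) (a : H →L[ℂ] H), cfc_mem a.2 _⟩)
  refine h1.trans ?_
  rw [spectralProjection, Submodule.starProjection_inj, coe_map_cfc h ha hf]

end VonNeumannAlgebra

namespace SelfAdjointPart

variable (h : A.toStarSubalgebra ≃⋆ₐ[ℂ] A.toStarSubalgebra)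

theorem spectralProjection_map (a : SelfAdjointPart A) (x : ℝ) :
    spectralProjection (a.map h).val x =
      h ⟨spectralProjection a.val x, VonNeumannAlgebra.spectralSubspace_mem a.mem x⟩ :=
  (VonNeumannAlgebra.map_spectralProjection h (a := ⟨a.val, a.mem⟩)
    (Subtype.ext a.isSelfAdjoint) x).symm

/-- The order of projections is the algebraic relation `Q * P = P`, which `h` preserves and
reflects. -/
theorem map_le_map_iff {a b : SelfAdjointPart A} : a.map h ≤ b.map h ↔ a ≤ b := by
  rw [le_iff, le_iff]
  refine forall_congr' fun x => ?_
  rw [Submodule.le_iff_starProjection_mul, Submodule.le_iff_starProjection_mul,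
    ← spectralProjection_eq, ← spectralProjection_eq, spectralProjection_map,
    spectralProjection_map, ← spectralProjection_eq, ← spectralProjection_eq]
  have := ((EquivLike.injective h).eq_iff
    (a := ⟨spectralProjection a.val x, VonNeumannAlgebra.spectralSubspace_mem a.mem x⟩ *
      ⟨spectralProjection b.val x, VonNeumannAlgebra.spectralSubspace_mem b.mem x⟩)
    (b := ⟨spectralProjection b.val x, VonNeumannAlgebra.spectralSubspace_mem b.mem x⟩))
  rw [map_mul, Subtype.ext_iff, Subtype.ext_iff] at this
  exact this

theorem map_map_symm (a : SelfAdjointPart A) : (a.map h.symm).map h = a :=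
  SelfAdjointPart.ext (congrArg Subtype.val (h.apply_symm_apply ⟨a.val, a.mem⟩))

/-- A `*`-automorphism as an order isomorphism for the spectral order. -/
noncomputable def mapOrderIso : SelfAdjointPart A ≃o SelfAdjointPart A where
  toFun := map h
  invFun := map h.symm
  left_inv a := map_map_symm h.symm a
  right_inv a := map_map_symm h a
  map_rel_iff' := map_le_map_iff h

theorem map_mem_iff {C D : Context A} (hD : (D.algebra : Set (H →L[ℂ] H)) =
      {y | ∃ c : A.toStarSubalgebra, (c : H →L[ℂ] H) ∈ C.algebra ∧ (h c : H →L[ℂ] H) = y})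
    {b : SelfAdjointPart A} : (b.map h).val ∈ D.algebra ↔ b.val ∈ C.algebra := by
  rw [← SetLike.mem_coe, hD]
  refine ⟨?_, fun hb => ⟨⟨b.val, b.mem⟩, hb, rfl⟩⟩
  rintro ⟨c, hc, hcb⟩
  have h1 : c = ⟨b.val, b.mem⟩ := EquivLike.injective h (Subtype.ext hcb)
  rw [h1] at hc
  exact hc

theorem above_map {C D : Context A} (hD : (D.algebra : Set (H →L[ℂ] H)) =
      {y | ∃ c : A.toStarSubalgebra, (c : H →L[ℂ] H) ∈ C.algebra ∧ (h c : H →L[ℂ] H) = y})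
    (a : SelfAdjointPart A) : D.above (a.map h) = mapOrderIso h '' C.above a := by
  ext b
  obtain ⟨b, rfl⟩ := (mapOrderIso h).surjective b
  rw [(mapOrderIso h).injective.mem_set_image]
  exact and_congr (map_mem_iff h hD) (map_le_map_iff h)

theorem below_map {C D : Context A} (hD : (D.algebra : Set (H →L[ℂ] H)) =
      {y | ∃ c : A.toStarSubalgebra, (c : H →L[ℂ] H) ∈ C.algebra ∧ (h c : H →L[ℂ] H) = y})
    (a : SelfAdjointPart A) : D.below (a.map h) = mapOrderIso h '' C.below a := by
  ext b
  obtain ⟨b, rfl⟩ := (mapOrderIso h).surjective b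
  rw [(mapOrderIso h).injective.mem_set_image]
  exact and_congr (map_mem_iff h hD) (map_le_map_iff h)

theorem map_outerDaseinisation {C D : Context A} (hD : (D.algebra : Set (H →L[ℂ] H)) =
      {y | ∃ c : A.toStarSubalgebra, (c : H →L[ℂ] H) ∈ C.algebra ∧ (h c : H →L[ℂ] H) = y})
    (a : SelfAdjointPart A) :
    (outerDaseinisation a C).map h = outerDaseinisation (a.map h) D := by
  refine Context.eq_of_isGLB (s := D.above (a.map h)) ?_ (D.isGLB_outerDaseinisation _)
  rw [above_map h hD]
  exact (mapOrderIso h).isGLB_image'.2 (C.isGLB_outerDaseinisation a)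

theorem map_innerDaseinisation {C D : Context A} (hD : (D.algebra : Set (H →L[ℂ] H)) =
      {y | ∃ c : A.toStarSubalgebra, (c : H →L[ℂ] H) ∈ C.algebra ∧ (h c : H →L[ℂ] H) = y})
    (a : SelfAdjointPart A) :
    (innerDaseinisation a C).map h = innerDaseinisation (a.map h) D := by
  refine Context.eq_of_isLUB (s := D.below (a.map h)) ?_ (D.isLUB_innerDaseinisation _)
  rw [below_map h hD]
  exact (mapOrderIso h).isLUB_image'.2 (C.isLUB_innerDaseinisation a)

end SelfAdjointPart

end Automorphism

/-! ### An order-theoretic criterion for being a von Neumann algebra -/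

section Bicommutant

variable {H : Type*} [NormedAddCommGroup H] [InnerProductSpace ℂ H] [CompleteSpace H]

omit [CompleteSpace H] in
theorem Submodule.starProjection_apply_eq_zero_iff_mem {K : Submodule ℂ H}
    [K.HasOrthogonalProjection] {ξ : H} : K.starProjection ξ = 0 ↔ ξ ∈ Kᗮ := by
  rw [← K.ker_starProjection]
  rfl

/-- Separation of two vectors by commuting projections that nearly fix the first and nearly
annihilate the second (a Borel-Cantelli argument). -/
theorem exists_dist_le_of_norm_starProjection_le {G : ℕ → Submodule ℂ H}
    [∀ n, (G n).HasOrthogonalProjection]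
    (hcomm : ∀ m n, Commute (G m).starProjection (G n).starProjection) {η : H}
    (hη : ∀ n, ‖(G n).starProjection η‖ ≤ 2 * (1 / 2) ^ n) (m : ℕ) :
    ∃ w ∈ ⨅ k, (G (m + k))ᗮ, dist η w ≤ 4 * (1 / 2) ^ m := by
  -- The components of `η` in `G m`, `G (m + 1)`, ... are removed one after another. By
  -- commutativity a later removal restores none of them and enlarges no remaining one, and the
  -- removed pieces are summable.
  let v : ℕ → H := fun k => Nat.rec η (fun k u => u - (G (m + k)).starProjection u) k
  have hv0 : v 0 = η := rfl
  have hv : ∀ k, v (k + 1) = v k - (G (m + k)).starProjection (v k) := fun k => rfl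
  have hP : ∀ n k, (G n).starProjection (v (k + 1)) =
      (G (m + k))ᗮ.starProjection ((G n).starProjection (v k)) := by
    intro n k
    have := congrArg (fun S : H →L[ℂ] H => S (v k)) (hcomm n (m + k)).eq
    simp only [mul_apply_eq_comp] at this
    rw [hv, map_sub, this, Submodule.starProjection_orthogonal_val]
  have hle : ∀ n k, ‖(G n).starProjection (v k)‖ ≤ ‖(G n).starProjection η‖ := by
    intro n k
    induction k with
    | zero => exact le_rfl
    | succ k ih =>
      rw [hP]
      exact (Submodule.norm_starProjection_apply_le _ _).trans ih
  have hzero : ∀ j k, j < k → (G (m + j)).starProjection (v k) = 0 := by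
    intro j k hjk
    induction k, hjk using Nat.le_induction with
    | base =>
      rw [hP]
      exact Submodule.starProjection_orthogonal_apply_eq_zero (Submodule.starProjection_apply_mem _ _)
    | succ k _ ih => rw [hP, ih, map_zero]
  have hdist : ∀ k, dist (v k) (v (k + 1)) ≤ 2 * (1 / 2 : ℝ) ^ m * (1 / 2) ^ k := by
    intro k
    rw [dist_eq_norm, hv, sub_sub_cancel]
    refine ((hle _ _).trans (hη _)).trans (le_of_eq ?_)
    rw [pow_add]
    ring
  obtain ⟨w, hw⟩ := cauchySeq_tendsto_of_complete
    (cauchySeq_of_le_geometric _ _ (by norm_num) hdist)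
  refine ⟨w, ?_, ?_⟩
  · rw [Submodule.mem_iInf]
    intro j
    rw [← Submodule.starProjection_apply_eq_zero_iff_mem]
    refine tendsto_nhds_unique (((G (m + j)).starProjection.continuous.tendsto w).comp hw) ?_
    refine tendsto_const_nhds.congr' ?_
    filter_upwards [Filter.eventually_gt_atTop j] with k hk using (hzero j k hk).symm
  · have := dist_le_of_le_geometric_of_tendsto₀ _ _ (by norm_num) hdist hw
    rw [hv0] at this
    refine this.trans (le_of_eq ?_)
    ring

-- The infimum of the closed spans of the tails is a limit superior of the `G n`. A vector `ω`
-- orthogonal to a whole tail pairs with `ξ` only through `ξ - (G n).starProjection ξ`, which tends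
-- to zero.
omit [CompleteSpace H] in
theorem mem_iInf_orthogonal_iInf_orthogonal {G : ℕ → Submodule ℂ H}
    [∀ n, (G n).HasOrthogonalProjection] {ξ : H}
    (hξ : ∀ n, ‖ξ - (G n).starProjection ξ‖ ≤ 2 * (1 / 2) ^ n) :
    ξ ∈ ⨅ m, (⨅ k, (G (m + k))ᗮ)ᗮ := by
  rw [Submodule.mem_iInf]
  intro m ω hω
  rw [Submodule.mem_iInf] at hω
  have hbound : ∀ k, ‖inner ℂ ω ξ‖ ≤ ‖ω‖ * (2 * (1 / 2) ^ (m + k)) := by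
    intro k
    have h1 : inner ℂ ω ((G (m + k)).starProjection ξ) = 0 :=
      Submodule.inner_left_of_mem_orthogonal (Submodule.starProjection_apply_mem _ _) (hω k)
    calc ‖inner ℂ ω ξ‖ = ‖inner ℂ ω (ξ - (G (m + k)).starProjection ξ)‖ := by
          rw [inner_sub_right, h1, sub_zero]
      _ ≤ ‖ω‖ * ‖ξ - (G (m + k)).starProjection ξ‖ := norm_inner_le_norm _ _
      _ ≤ _ := by gcongr; exact hξ _
  have hlim : Filter.Tendsto (fun k : ℕ => ‖ω‖ * (2 * (1 / 2 : ℝ) ^ (m + k))) Filter.atTop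
      (nhds (‖ω‖ * (2 * ((1 / 2 : ℝ) ^ m * 0)))) := by
    simp only [pow_add]
    exact (((tendsto_pow_atTop_nhds_zero_of_lt_one (by norm_num) (by norm_num)).const_mul
      _).const_mul _).const_mul _
  have := ge_of_tendsto' hlim hbound
  rw [mul_zero, mul_zero, mul_zero] at this
  exact norm_le_zero_iff.1 this

/-- `η` is a limit of vectors each orthogonal to an entire tail, hence to the limit superior. -/
theorem mem_orthogonal_iInf_orthogonal_iInf_orthogonal {G : ℕ → Submodule ℂ H}
    [∀ n, (G n).HasOrthogonalProjection]
    (hcomm : ∀ m n, Commute (G m).starProjection (G n).starProjection) {η : H}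
    (hη : ∀ n, ‖(G n).starProjection η‖ ≤ 2 * (1 / 2) ^ n) :
    η ∈ (⨅ m, (⨅ k, (G (m + k))ᗮ)ᗮ)ᗮ := by
  choose w hw hdist using exists_dist_le_of_norm_starProjection_le hcomm hη
  have hlim : Filter.Tendsto w Filter.atTop (nhds η) := by
    rw [tendsto_iff_dist_tendsto_zero]
    refine squeeze_zero (fun _ => dist_nonneg) (fun m => dist_comm (w m) η ▸ hdist m) ?_
    simpa using (tendsto_pow_atTop_nhds_zero_of_lt_one (r := (1 / 2 : ℝ)) (by norm_num)
      (by norm_num)).const_mul 4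
  have hcl : IsClosed (((⨅ m, (⨅ k, (G (m + k))ᗮ)ᗮ)ᗮ : Submodule ℂ H) : Set H) :=
    Submodule.isClosed_orthogonal _
  refine hcl.mem_of_tendsto hlim (.of_forall fun m => ?_)
  exact Submodule.orthogonal_le (iInf_le _ m) (Submodule.le_orthogonal_orthogonal _ (hw m))

variable {B : StarSubalgebra ℂ (H →L[ℂ] H)}

/-- The bicommutant of a `*`-algebra of operators. -/
noncomputable def StarSubalgebra.bicommutant (B : StarSubalgebra ℂ (H →L[ℂ] H)) :
    VonNeumannAlgebra H where
  toStarSubalgebra := StarSubalgebra.centralizer ℂ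
    (StarSubalgebra.centralizer ℂ (B : Set (H →L[ℂ] H)) : Set (H →L[ℂ] H))
  centralizer_centralizer' := by simp

namespace StarSubalgebra

theorem coe_bicommutant : (B.bicommutant : Set (H →L[ℂ] H)) =
    Set.centralizer (Set.centralizer (B : Set (H →L[ℂ] H))) := by
  change ((StarSubalgebra.centralizer ℂ
    (StarSubalgebra.centralizer ℂ (B : Set (H →L[ℂ] H)) : Set (H →L[ℂ] H)) :
      StarSubalgebra ℂ (H →L[ℂ] H)) : Set (H →L[ℂ] H)) = _
  rw [StarSubalgebra.coe_centralizer, StarMemClass.star_coe_eq, Set.union_self,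
    StarSubalgebra.coe_centralizer, StarMemClass.star_coe_eq, Set.union_self]

theorem mem_bicommutant_iff {T : H →L[ℂ] H} :
    T ∈ B.bicommutant ↔ ∀ S ∈ Set.centralizer (B : Set (H →L[ℂ] H)), S * T = T * S := by
  rw [← SetLike.mem_coe, coe_bicommutant]
  rfl

/-- Von Neumann's density argument: the projection onto the closure of `B ζ` commutes with `B`,
hence with `T`, and `ζ` lies in that closure because `1 ∈ B`. -/
theorem exists_norm_sub_lt_of_mem_bicommutant {T : H →L[ℂ] H} (hT : T ∈ B.bicommutant) (ζ : H)
    {ε : ℝ} (hε : 0 < ε) : ∃ d ∈ B, ‖T ζ - d ζ‖ < ε := by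
  let V : Submodule ℂ H := (Subalgebra.toSubmodule B.toSubalgebra).map
    (ContinuousLinearMap.apply ℂ H ζ).toLinearMap
  have hV : ∀ {ξ}, ξ ∈ V ↔ ∃ d ∈ B, d ζ = ξ := Iff.rfl
  have hinv : ∀ S ∈ B, ∀ ξ ∈ V.topologicalClosure, S ξ ∈ V.topologicalClosure := by
    intro S hS ξ hξ
    refine map_mem_closure S.continuous hξ ?_
    rintro _ ⟨d, hd, rfl⟩
    exact ⟨S * d, B.mul_mem hS hd, rfl⟩
  have hc : V.topologicalClosure.starProjection ∈ Set.centralizer (B : Set (H →L[ℂ] H)) :=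
    fun S hS => Submodule.commute_starProjection (hinv S hS) (hinv _ (star_mem hS))
  have hζ : ζ ∈ V.topologicalClosure := V.le_topologicalClosure (hV.2 ⟨1, one_mem B, rfl⟩)
  have h1 : T ζ ∈ V.topologicalClosure := Submodule.apply_mem_of_commute_starProjection
    (mem_bicommutant_iff.1 hT _ hc).symm hζ
  obtain ⟨_, ⟨d, hd, rfl⟩, h⟩ := Metric.mem_closure_iff.1 h1 ε hε
  exact ⟨d, hd, by rwa [dist_eq_norm] at h⟩

theorem commute_of_mem_bicommutant (hB : ∀ S ∈ B, ∀ T ∈ B, S * T = T * S) {S T : H →L[ℂ] H}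
    (hS : S ∈ B) (hT : T ∈ B.bicommutant) : Commute S T :=
  mem_bicommutant_iff.1 hT S fun U hU => hB U hU S hS

theorem reApplyInnerSelf_star_mul_self (d : H →L[ℂ] H) (ω : H) :
    (star d * d).reApplyInnerSelf ω = ‖d ω‖ ^ 2 := by
  rw [ContinuousLinearMap.reApplyInnerSelf_apply, mul_apply_eq_comp,
    ContinuousLinearMap.star_eq_adjoint, ContinuousLinearMap.adjoint_inner_left,
    inner_self_eq_norm_sq]

/-- Where `star d * d` is at most `1 / 4`, `d` at least halves norms, so a vector nearly fixed by
`d` has little mass there. The companion bound uses that `d` shrinks norms by at most half on the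
complement. -/
theorem norm_starProjection_sub_le {d : H →L[ℂ] H} {ξ : H} {ε : ℝ} (h : ‖ξ - d ξ‖ ≤ ε)
    (hd : Commute d (spectralSubspace (star d * d) (1 / 4)).starProjection) :
    ‖(spectralSubspace (star d * d) (1 / 4)).starProjection ξ‖ ≤ 2 * ε := by
  set S := spectralSubspace (star d * d) (1 / 4)
  have h1 : ‖S.starProjection ξ - d (S.starProjection ξ)‖ ≤ ε := by
    have := congrArg (fun U : H →L[ℂ] H => U ξ) hd.eq
    simp only [mul_apply_eq_comp] at this
    rw [this, ← map_sub]
    exact (Submodule.norm_starProjection_apply_le _ _).trans h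
  have h2 := reApplyInnerSelf_le_of_mem_spectralSubspace (.star_mul_self d)
    (S.starProjection_apply_mem ξ)
  rw [reApplyInnerSelf_star_mul_self] at h2
  have h3 : ‖d (S.starProjection ξ)‖ ≤ 1 / 2 * ‖S.starProjection ξ‖ := by
    refine le_of_sq_le_sq ?_ (by positivity)
    rw [mul_pow]
    linarith
  have h4 := norm_sub_norm_le (S.starProjection ξ) (d (S.starProjection ξ))
  linarith

theorem norm_starProjection_orthogonal_le {d : H →L[ℂ] H} {η : H} {ε : ℝ} (h : ‖d η‖ ≤ ε)
    (hd : Commute d (spectralSubspace (star d * d) (1 / 4)).starProjection) :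
    ‖(spectralSubspace (star d * d) (1 / 4))ᗮ.starProjection η‖ ≤ 2 * ε := by
  set S := spectralSubspace (star d * d) (1 / 4)
  set ω := Sᗮ.starProjection η with hω
  have h1 : ‖d ω‖ ≤ ε := by
    have h0 : d ω = Sᗮ.starProjection (d η) := by
      have := congrArg (fun U : H →L[ℂ] H => U η) hd.eq
      simp only [mul_apply_eq_comp] at this
      rw [hω, Submodule.starProjection_orthogonal_val, Submodule.starProjection_orthogonal_val,
        map_sub, this]
    rw [h0]
    exact (Submodule.norm_starProjection_apply_le _ _).trans h
  rcases eq_or_ne ω 0 with h0 | h0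
  · rw [h0, norm_zero]
    linarith [(norm_nonneg _).trans h1]
  have h2 := lt_reApplyInnerSelf_of_mem_orthogonal (.star_mul_self d)
    (Sᗮ.starProjection_apply_mem η) h0
  rw [reApplyInnerSelf_star_mul_self] at h2
  have h3 : 1 / 2 * ‖ω‖ ≤ ‖d ω‖ := by
    refine le_of_sq_le_sq ?_ (by positivity)
    rw [mul_pow]
    linarith
  linarith

theorem exists_starProjection_mem_separating (hB : ∀ S ∈ B, ∀ T ∈ B, S * T = T * S)
    (hspec : ∀ b ∈ B, IsSelfAdjoint b → ∀ x, (spectralSubspace b x).starProjection ∈ B)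
    {K : Submodule ℂ H} [K.HasOrthogonalProjection] (hK : K.starProjection ∈ B.bicommutant)
    {ξ η : H} (hξ : ξ ∈ K) (hη : η ∈ Kᗮ) {ε : ℝ} (hε : 0 < ε) :
    ∃ (G : Submodule ℂ H) (_ : G.HasOrthogonalProjection), G.starProjection ∈ B ∧
      ‖ξ - G.starProjection ξ‖ ≤ 2 * ε ∧ ‖G.starProjection η‖ ≤ 2 * ε := by
  -- One vector suffices: `d` commutes with the projection onto `K`, so the approximation at `ξ + η`
  -- splits into `d ξ` near `ξ` and `d η` near `0`.
  obtain ⟨d, hd, h⟩ := exists_norm_sub_lt_of_mem_bicommutant hK (ξ + η) hε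
  have hdK : Commute d K.starProjection := commute_of_mem_bicommutant hB hd hK
  have hdξ := Submodule.apply_mem_of_commute_starProjection hdK hξ
  have hdη := Submodule.apply_mem_orthogonal_of_commute_starProjection hdK hη
  rw [map_add, K.starProjection_eq_self_iff.2 hξ,
    Submodule.starProjection_apply_eq_zero_iff_mem.2 hη, add_zero, map_add] at h
  have hS := hspec (star d * d) (mul_mem (star_mem hd) hd) (.star_mul_self d) (1 / 4)
  have hdS : Commute d (spectralSubspace (star d * d) (1 / 4)).starProjection := hB _ hd _ hS
  refine ⟨(spectralSubspace (star d * d) (1 / 4))ᗮ, inferInstance, ?_, ?_, ?_⟩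
  · rw [Submodule.starProjection_orthogonal']
    exact sub_mem (one_mem B) hS
  · rw [Submodule.starProjection_orthogonal_val, sub_sub_cancel]
    refine norm_starProjection_sub_le ?_ hdS
    have h1 : K.starProjection (ξ - (d ξ + d η)) = ξ - d ξ := by
      rw [map_sub, map_add, K.starProjection_eq_self_iff.2 hξ, K.starProjection_eq_self_iff.2 hdξ,
        Submodule.starProjection_apply_eq_zero_iff_mem.2 hdη, add_zero]
    rw [← h1]
    exact (Submodule.norm_starProjection_apply_le _ _).trans h.le
  · refine norm_starProjection_orthogonal_le ?_ hdS
    have h1 : Kᗮ.starProjection (ξ - (d ξ + d η)) = -d η := by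
      rw [map_sub, map_add, Submodule.starProjection_orthogonal_apply_eq_zero hξ,
        Submodule.starProjection_orthogonal_apply_eq_zero hdξ,
        Submodule.starProjection_eq_self_iff.2 hdη, zero_add, zero_sub]
    rw [← norm_neg, ← h1]
    exact (Submodule.norm_starProjection_apply_le _ _).trans h.le

variable (B) in
/-- The projections in `B` are closed under arbitrary infima. -/
def InfClosedProjections : Prop :=
  ∀ (S : Set (Submodule ℂ H)),
    (∀ K ∈ S, ∃ _ : K.HasOrthogonalProjection, K.starProjection ∈ B) →
      ∃ _ : (sInf S).HasOrthogonalProjection, (sInf S).starProjection ∈ B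

theorem InfClosedProjections.iInf_mem (hinf : B.InfClosedProjections) {ι : Sort*}
    {K : ι → Submodule ℂ H} [∀ i, (K i).HasOrthogonalProjection]
    (h : ∀ i, (K i).starProjection ∈ B) : (⨅ i, K i).starProjection ∈ B := by
  obtain ⟨_, h1⟩ := hinf (Set.range K) (by rintro _ ⟨i, rfl⟩; exact ⟨inferInstance, h i⟩)
  exact h1

theorem starProjection_orthogonal_mem {K : Submodule ℂ H} [K.HasOrthogonalProjection]
    (h : K.starProjection ∈ B) : Kᗮ.starProjection ∈ B := by
  rw [Submodule.starProjection_orthogonal']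
  exact sub_mem (one_mem B) h

/-- `L ξ` is the smallest subspace through `ξ` with projection in `B`. Once `L ξ ≤ K` for all `ξ ∈
K`, `K` is the closed span of these subspaces. -/
theorem starProjection_mem_of_mem_bicommutant (hB : ∀ S ∈ B, ∀ T ∈ B, S * T = T * S)
    (hspec : ∀ b ∈ B, IsSelfAdjoint b → ∀ x, (spectralSubspace b x).starProjection ∈ B)
    (hinf : B.InfClosedProjections)
    {K : Submodule ℂ H} [K.HasOrthogonalProjection] (hK : K.starProjection ∈ B.bicommutant) :
    K.starProjection ∈ B := by
  let L : H → Submodule ℂ H := fun ξ =>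
    sInf {G | (∃ _ : G.HasOrthogonalProjection, G.starProjection ∈ B) ∧ ξ ∈ G}
  have hL : ∀ ξ, ∃ _ : (L ξ).HasOrthogonalProjection, (L ξ).starProjection ∈ B :=
    fun ξ => hinf _ fun G hG => hG.1
  have : ∀ ξ, (L ξ).HasOrthogonalProjection := fun ξ => (hL ξ).1
  have hLB : ∀ ξ, (L ξ).starProjection ∈ B := fun ξ => (hL ξ).2
  have hmem : ∀ ξ, ξ ∈ L ξ := fun ξ => by
    rw [Submodule.mem_sInf]
    exact fun G hG => hG.2
  have hLK : ∀ ξ ∈ K, L ξ ≤ K := by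
    intro ξ hξ ω hω
    rw [← Submodule.starProjection_orthogonal_apply_eq_zero_iff]
    set η := Kᗮ.starProjection ω with hη
    have hηK : η ∈ Kᗮ := Submodule.starProjection_apply_mem _ _
    have hηL : η ∈ L ξ := by
      rw [hη, Submodule.starProjection_orthogonal_val]
      exact sub_mem hω (Submodule.apply_mem_of_commute_starProjection
        (commute_of_mem_bicommutant hB (hLB ξ) hK).symm hω)
    -- With summable errors, the limit superior of the `G n` contains `ξ`, hence `L ξ` and so `η`;
    -- but it is also orthogonal to `η`, so `η = 0`.
    choose G hG hGB hGξ hGη using fun n : ℕ =>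
      exists_starProjection_mem_separating hB hspec hK hξ hηK (ε := (1 / 2) ^ n) (by positivity)
    have hG1 : (⨅ m, (⨅ k, (G (m + k))ᗮ)ᗮ).starProjection ∈ B :=
      hinf.iInf_mem fun m => starProjection_orthogonal_mem <|
        hinf.iInf_mem fun k => starProjection_orthogonal_mem (hGB _)
    have h1 := mem_iInf_orthogonal_iInf_orthogonal hGξ
    have h2 := mem_orthogonal_iInf_orthogonal_iInf_orthogonal
      (fun m n => hB _ (hGB m) _ (hGB n)) hGη
    have h3 : η ∈ ⨅ m, (⨅ k, (G (m + k))ᗮ)ᗮ :=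
      Submodule.mem_sInf.1 hηL _ ⟨⟨inferInstance, hG1⟩, h1⟩
    exact inner_self_eq_zero.1 (Submodule.inner_right_of_mem_orthogonal h3 h2)
  have hKL : K = (⨅ ξ : K, (L ξ)ᗮ)ᗮ :=
    le_antisymm (fun ξ hξ =>
      Submodule.le_orthogonal_iInf_orthogonal (fun ξ : K => L ξ) ⟨ξ, hξ⟩ (hmem ξ))
      (Submodule.orthogonal_iInf_orthogonal_le fun ξ => hLK ξ ξ.2)
  rw [Submodule.starProjection_inj.2 hKL]
  exact starProjection_orthogonal_mem <| hinf.iInf_mem fun ξ =>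
    starProjection_orthogonal_mem (hLB ξ)

/-- An abelian norm-closed `*`-algebra that contains the spectral projections of its self-adjoint
elements, and whose projections are closed under infima, is its own bicommutant. -/
theorem centralizer_centralizer_eq (hcl : IsClosed (B : Set (H →L[ℂ] H)))
    (hB : ∀ S ∈ B, ∀ T ∈ B, S * T = T * S)
    (hspec : ∀ b ∈ B, IsSelfAdjoint b → ∀ x, (spectralSubspace b x).starProjection ∈ B)
    (hinf : B.InfClosedProjections) :
    Set.centralizer (Set.centralizer (B : Set (H →L[ℂ] H))) = B := by
  refine Set.Subset.antisymm ?_ Set.subset_centralizer_centralizer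
  rw [← coe_bicommutant]
  have hsa : ∀ y ∈ B.bicommutant, IsSelfAdjoint y → y ∈ B := by
    intro y hy hys
    -- `y` is rebuilt from its own spectral family, to use that the rebuilt operator lies in any
    -- closed subalgebra containing the projections.
    obtain ⟨a, ha, haE, hmem⟩ := exists_spectralSubspace_eq (E := spectralSubspace y)
      (spectralSubspace_mono hys) (fun x ξ h => mem_spectralSubspace_of_forall_lt hys h)
      (fun x hx => spectralSubspace_eq_bot hys hx) (fun x hx => spectralSubspace_eq_top hys hx)
    rw [← eq_of_spectralSubspace_eq ha hys (funext haE)]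
    exact hmem B.toSubalgebra hcl fun x => starProjection_mem_of_mem_bicommutant hB hspec hinf
      (VonNeumannAlgebra.spectralSubspace_mem hy x)
  intro y hy
  have hy' : star y ∈ B.bicommutant := star_mem hy
  have h1 := hsa (y + star y) (add_mem hy hy') (IsSelfAdjoint.add_star_self y)
  have h2 := hsa (Complex.I • (y - star y))
    (B.bicommutant.toStarSubalgebra.smul_mem (sub_mem hy hy') _) (by
      rw [IsSelfAdjoint, star_smul, star_sub, star_star, Complex.star_def, Complex.conj_I,
        neg_smul, ← smul_neg, neg_sub])
  have h3 : y = (1 / 2 : ℂ) • (y + star y) + (-Complex.I / 2) • (Complex.I • (y - star y)) := by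
    rw [smul_smul, show -Complex.I / 2 * Complex.I = 1 / 2 by
      rw [div_mul_eq_mul_div, neg_mul, Complex.I_mul_I, neg_neg]]
    module
  rw [h3]
  exact add_mem (B.smul_mem h1 _) (B.smul_mem h2 _)

end StarSubalgebra

end Bicommutant

/-! ### The image of a context is a context -/

section Image

variable {H : Type*} [NormedAddCommGroup H] [InnerProductSpace ℂ H] [CompleteSpace H]
  {A : VonNeumannAlgebra H}

namespace Context

variable (h : A.toStarSubalgebra ≃⋆ₐ[ℂ] A.toStarSubalgebra) (C : Context A)

/-- The image `h[C]` of a context under a `*`-automorphism, as a `*`-subalgebra. -/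
noncomputable def imageStarSubalgebra : StarSubalgebra ℂ (H →L[ℂ] H) :=
  (((C.algebra.toStarSubalgebra.comap A.toStarSubalgebra.subtype).map
    (h : A.toStarSubalgebra →⋆ₐ[ℂ] A.toStarSubalgebra)).map A.toStarSubalgebra.subtype)

theorem mem_imageStarSubalgebra_iff {y : H →L[ℂ] H} :
    y ∈ C.imageStarSubalgebra h ↔
      ∃ c : A.toStarSubalgebra, (c : H →L[ℂ] H) ∈ C.algebra ∧ (h c : H →L[ℂ] H) = y := by
  constructor
  · rintro ⟨_, ⟨c, hc, rfl⟩, rfl⟩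
    exact ⟨c, hc, rfl⟩
  · rintro ⟨c, hc, rfl⟩
    exact ⟨_, ⟨c, hc, rfl⟩, rfl⟩

theorem coe_imageStarSubalgebra : (C.imageStarSubalgebra h : Set (H →L[ℂ] H)) =
    {y | ∃ c : A.toStarSubalgebra, (c : H →L[ℂ] H) ∈ C.algebra ∧ (h c : H →L[ℂ] H) = y} :=
  Set.ext fun _ => C.mem_imageStarSubalgebra_iff h

theorem isClosed_imageStarSubalgebra :
    IsClosed (C.imageStarSubalgebra h : Set (H →L[ℂ] H)) := by
  have h1 : Isometry fun c : A.toStarSubalgebra => (h c : H →L[ℂ] H) :=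
    isometry_subtype_coe.comp (VonNeumannAlgebra.isometry_starAlgEquiv h)
  have h2 : IsClosed ((fun c : A.toStarSubalgebra => (c : H →L[ℂ] H)) ⁻¹' C.algebra) :=
    C.algebra.isClosed.preimage continuous_subtype_val
  rw [coe_imageStarSubalgebra]
  exact h1.isClosedEmbedding.isClosedMap _ h2

theorem imageStarSubalgebra_comm : ∀ S ∈ C.imageStarSubalgebra h,
    ∀ T ∈ C.imageStarSubalgebra h, S * T = T * S := by
  intro S hS T hT
  obtain ⟨c, hc, rfl⟩ := (C.mem_imageStarSubalgebra_iff h).1 hS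
  obtain ⟨d, hd, rfl⟩ := (C.mem_imageStarSubalgebra_iff h).1 hT
  have h1 : c * d = d * c := Subtype.ext (C.comm _ hc _ hd)
  have h2 := congrArg h h1
  rw [map_mul, map_mul] at h2
  exact congrArg Subtype.val h2

theorem spectralSubspace_mem_imageStarSubalgebra : ∀ b ∈ C.imageStarSubalgebra h,
    IsSelfAdjoint b → ∀ x, (spectralSubspace b x).starProjection ∈ C.imageStarSubalgebra h := by
  intro b hb hbs x
  obtain ⟨c, hc, rfl⟩ := (C.mem_imageStarSubalgebra_iff h).1 hb
  have hcs : IsSelfAdjoint c := by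
    refine EquivLike.injective h ?_
    rw [map_star]
    exact Subtype.ext hbs
  rw [mem_imageStarSubalgebra_iff]
  exact ⟨_, VonNeumannAlgebra.spectralSubspace_mem hc x,
    VonNeumannAlgebra.map_spectralProjection h hcs x⟩

theorem infClosedProjections_imageStarSubalgebra :
    (C.imageStarSubalgebra h).InfClosedProjections := by
  intro S hS
  have hOP : ∀ K : S, (K : Submodule ℂ H).HasOrthogonalProjection := fun K => (hS K K.2).1
  have hSh : ∀ K : S, ∃ c : A.toStarSubalgebra, (c : H →L[ℂ] H) ∈ C.algebra ∧
      (h c : H →L[ℂ] H) = (K : Submodule ℂ H).starProjection := fun K =>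
    (C.mem_imageStarSubalgebra_iff h).1 (hS K K.2).2
  choose p hpC hp using hSh
  have hpL : ∀ K : S, ∃ (L : Submodule ℂ H) (_ : L.HasOrthogonalProjection),
      (p K : H →L[ℂ] H) = L.starProjection := fun K => by
    have h1 := VonNeumannAlgebra.exists_map_eq_starProjection h.symm (p := h (p K))
      (by rw [hp]; exact isStarProjection_starProjection)
    rwa [StarAlgEquiv.symm_apply_apply] at h1
  choose L hLOP hL using hpL
  rw [sInf_eq_iInf']
  refine ⟨inferInstance, (C.mem_imageStarSubalgebra_iff h).2 ?_⟩
  have hsC : (⨅ K, L K).starProjection ∈ C.algebra :=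
    VonNeumannAlgebra.starProjection_iInf_mem fun K => hL K ▸ hpC K
  let s : A.toStarSubalgebra := ⟨(⨅ K, L K).starProjection, C.le hsC⟩
  refine ⟨s, hsC, ?_⟩
  obtain ⟨M, hMOP, hM⟩ := VonNeumannAlgebra.exists_map_eq_starProjection h (p := s)
    isStarProjection_starProjection
  -- The infimum taken in `H` has its projection in `A`, so it can be pulled back by `h.symm` and
  -- compared with the infimum of the preimages, whose projection lies in `C`.
  have hqA : (⨅ K : S, (K : Submodule ℂ H)).starProjection ∈ A :=
    VonNeumannAlgebra.starProjection_iInf_mem fun K => hp K ▸ (h (p K)).2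
  let q : A.toStarSubalgebra := ⟨(⨅ K : S, (K : Submodule ℂ H)).starProjection, hqA⟩
  obtain ⟨R, hROP, hR⟩ := VonNeumannAlgebra.exists_map_eq_starProjection h.symm (p := q)
    isStarProjection_starProjection
  rw [hM, Submodule.starProjection_inj]
  refine le_antisymm (le_iInf fun K => ?_) ?_
  · rw [Submodule.le_iff_starProjection_mul, ← hp, ← hM]
    have h1 : p K * s = s := Subtype.ext (by
      change (p K : H →L[ℂ] H) * _ = _
      rw [hL]
      exact Submodule.le_iff_starProjection_mul.1 (iInf_le _ K))
    have h2 := congrArg h h1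
    rw [map_mul] at h2
    exact congrArg Subtype.val h2
  · have hRL : R ≤ ⨅ K, L K := by
      refine le_iInf fun K => ?_
      rw [Submodule.le_iff_starProjection_mul, ← hL, ← hR]
      have h1 : h (p K) * q = q := Subtype.ext (by
        change (h (p K) : H →L[ℂ] H) * _ = _
        rw [hp]
        exact Submodule.le_iff_starProjection_mul.1 (iInf_le _ K))
      have h2 := congrArg h.symm h1
      rw [map_mul, StarAlgEquiv.symm_apply_apply] at h2
      exact congrArg Subtype.val h2
    have h1 : s * h.symm q = h.symm q := Subtype.ext (by
      change (⨅ K, L K).starProjection * (h.symm q : H →L[ℂ] H) = _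
      rw [hR]
      exact Submodule.le_iff_starProjection_mul.1 hRL)
    have h2 := congrArg h h1
    rw [map_mul, StarAlgEquiv.apply_symm_apply] at h2
    rw [Submodule.le_iff_starProjection_mul, ← hM]
    exact congrArg Subtype.val h2

/-- The image `h[C]` of a context under a `*`-automorphism is a context. -/
noncomputable def image : Context A where
  algebra :=
    { toStarSubalgebra := C.imageStarSubalgebra h
      centralizer_centralizer' := StarSubalgebra.centralizer_centralizer_eq
        (C.isClosed_imageStarSubalgebra h) (C.imageStarSubalgebra_comm h)
        (C.spectralSubspace_mem_imageStarSubalgebra h)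
        (C.infClosedProjections_imageStarSubalgebra h) }
  le y hy := by
    obtain ⟨c, _, rfl⟩ := (C.mem_imageStarSubalgebra_iff h).1 hy
    exact (h c).2
  comm := C.imageStarSubalgebra_comm h

end Context

end Image

theorem corollary5p16 {H : Type*} [NormedAddCommGroup H] [InnerProductSpace ℂ H]
    [CompleteSpace H] (A : VonNeumannAlgebra H)
    (h : A.toStarSubalgebra ≃⋆ₐ[ℂ] A.toStarSubalgebra)
    (a : SelfAdjointPart A) (C : Context A) :
    -- the image `h[C]` is again a context `D`
    ∃ D : Context A,
      (D.algebra : Set (H →L[ℂ] H)) =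
        {y | ∃ c : A.toStarSubalgebra, (c : H →L[ℂ] H) ∈ C.algebra ∧ (h c : H →L[ℂ] H) = y} ∧
      -- the meets and joins that define the daseinisations exist, and lie in the context
      (IsGLB (C.above a) (outerDaseinisation a C) ∧
        (outerDaseinisation a C).val ∈ C.algebra) ∧
      (IsGLB (D.above (a.map h)) (outerDaseinisation (a.map h) D) ∧
        (outerDaseinisation (a.map h) D).val ∈ D.algebra) ∧
      (IsLUB (C.below a) (innerDaseinisation a C) ∧
        (innerDaseinisation a C).val ∈ C.algebra) ∧
      (IsLUB (D.below (a.map h)) (innerDaseinisation (a.map h) D) ∧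
        (innerDaseinisation (a.map h) D).val ∈ D.algebra) ∧
      -- the two identities
      (outerDaseinisation a C).map h = outerDaseinisation (a.map h) D ∧
      (innerDaseinisation a C).map h = innerDaseinisation (a.map h) D := by

  have hD := C.coe_imageStarSubalgebra h
  exact ⟨C.image h, hD,
    ⟨C.isGLB_outerDaseinisation a, C.outerDaseinisation_mem a⟩,
    ⟨(C.image h).isGLB_outerDaseinisation _, (C.image h).outerDaseinisation_mem _⟩,
    ⟨C.isLUB_innerDaseinisation a, C.innerDaseinisation_mem a⟩,
    ⟨(C.image h).isLUB_innerDaseinisation _, (C.image h).innerDaseinisation_mem _⟩,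
    SelfAdjointPart.map_outerDaseinisation h hD a,
    SelfAdjointPart.map_innerDaseinisation h hD a⟩
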